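/- Let $d\in\{2,3\}$ and let $\Omega\subset\mathbb R^d$ be a bounded open set (for instance a Lipschitz polytopal domain). $H^1_0(\Omega)^d$ is the closure of $C_c^\infty(\Omega)^d$ in $H^1(\Omega)^d$, $V=\{\mathbf w\in H^1_0(\Omega)^d:\operatorname{div}\mathbf w=0\}$, $L^2_0(\Omega)=\{q\in L^2(\Omega):\int_\Omega q=0\}$, $\boldsymbol\varepsilon(\mathbf w)=\frac12(\nabla\mathbf w+(\nabla\mathbf w)^t)$, and $\|\cdot\|$ is the $L^2(\Omega)$ norm (with the Euclidean or Frobenius norm pointwise). There are positive constants $\mathcal P,\mathcal K$ with $$\|\mathbf w\|\le\mathcal P\|\nabla\mathbf w\|,\qquad \|\nabla\mathbf w\|\le\mathcal K\|\boldsymbol\varepsilon(\mathbf w)\|\qquad\forall\,\mathbf w\in H^1_0(\Omega)^d; \tag{1}$$ let $\mathcal P,\mathcal K>0$ be any constants satisfying (1). **Parameters.** Let $\alpha,\nu,\varrho,\delta,E_1>0$, $E_2<0$, $E_1-d|E_2|>0$, $\lambda_1,\lambda_2\in\mathbb R$. Let $T_\delta f=f$ if $|f|\le\delta$ and $T_\delta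 f=\delta\,\mathrm{sign}(f)$ otherwise, $F(f)=E_1(1+\lambda_1f)-d|E_2|(1+\lambda_2f)$, and $$\gamma_1=\tfrac1{1+|\lambda_1|\delta},\quad \gamma_2=\tfrac1{1-|\lambda_1|\delta},\quad \gamma_3=E_1+dE_2,\quad \gamma_4=E_1\lambda_1+dE_2\lambda_2,$$ $$\gamma_5=\tfrac1{\gamma_3+|\gamma_4|\delta},\quad \gamma_6=\tfrac1{\gamma_3-|\gamma_4|\delta},\quad \gamma_7=1-|\lambda_2|\delta,\quad \gamma_8=1+|\lambda_2|\delta.$$ Assume that $\lambda_1,\lambda_2$ are small enough that $1-|\lambda_1|\delta>0$, $\gamma_3-|\gamma_4|\delta>0$ and $\gamma_7>0$; then for every $\mathbf w\in H^1_0(\Omega)^d$ the truncated coefficients satisfy $\gamma_1\le(1+\lambda_1T_\delta\operatorname{div}\mathbf w)^{-1}\le\gamma_2$, $\gamma_5\le F(T_\delta\operatorname{div}\mathbf w)^{-1}\le\gamma_6$ and $0<\gamma_7\le1+\lambda_2T_\delta\operatorname{div}\mathbf w\le\gamma_8$. **Discretization.** Fix $C>0$. For $h>0$ let $\boldsymbol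 U_h,\boldsymbol X_h\subset H^1_0(\Omega)^d$ and $Q_h\subset L^2_0(\Omega)$ be finite-dimensional subspaces, let $\boldsymbol V_h=\{\mathbf v\in\boldsymbol X_h:\int_\Omega q\operatorname{div}\mathbf v=0\ \forall q\in Q_h\}$, and let operators, both denoted $\Pi_h$, from $H^1_0(\Omega)^d$ to $\boldsymbol U_h$ and from $V$ to $\boldsymbol V_h$ satisfy, for all $\mathbf w$ in their domains, $\|\nabla\Pi_h\mathbf w\|\le C\|\nabla\mathbf w\|$ and $\|\mathbf w-\Pi_h\mathbf w\|\le Ch\|\nabla\mathbf w\|$. Let $T>0$, $N>1$, $\Delta t=T/N$, $t_n=n\Delta t$, $\mathbf u_0\in H^1_0(\Omega)^d$ and $\mathbf v_0\in V$. Let $\mathbf u_h^0=\Pi_h\mathbf u_0$, $\mathbf v_h^0=\Pi_h\mathbf v_0$, and for $1\le n\le N$ let $(\mathbf u_h^n,\mathbf v_h^n,p_h^n)\in\boldsymbol U_h\times\boldsymbol V_h\times Q_h$ satisfy, for all $\mathbf z_h\in\boldsymbol U_h$ and $\mathbf w_h\in\boldsymbol X_h$, with $\theta=T_\delta\operatorname{div}\mathbf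 u_h^{n-1}$, $$\frac{\alpha}{\Delta t}\int_\Omega(\mathbf u_h^n-\mathbf u_h^{n-1})\cdot\mathbf z_h+\frac1{E_1}\int_\Omega\frac{\boldsymbol\varepsilon(\mathbf u_h^n):\boldsymbol\varepsilon(\mathbf z_h)}{1+\lambda_1\theta}+\frac{|E_2|}{E_1}\int_\Omega\frac{1+\lambda_2\theta}{1+\lambda_1\theta}\,\frac{\operatorname{div}\mathbf u_h^n\,\operatorname{div}\mathbf z_h}{F(\theta)}=\alpha\int_\Omega\mathbf v_h^n\cdot\mathbf z_h,$$ $$\frac{\varrho}{\Delta t}\int_\Omega(\mathbf v_h^n-\mathbf v_h^{n-1})\cdot\mathbf w_h-\int_\Omega p_h^n\operatorname{div}\mathbf w_h+\nu\int_\Omega\nabla\mathbf v_h^n:\nabla\mathbf w_h+\alpha\int_\Omega\mathbf v_h^n\cdot\mathbf w_h=\frac{\alpha}{\Delta t}\int_\Omega(\mathbf u_h^n-\mathbf u_h^{n-1})\cdot\mathbf w_h.$$ **Constants.** Set $$\mathcal D_1=\frac{(\gamma_6\gamma_8)^2}{\gamma_5\gamma_7}|E_2|,\quad \mathcal D_2=1+\frac{\mathcal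 D_1}2,\quad \mathcal D_3=\frac{(\alpha h)^2}{\Delta t}+\frac{\alpha}{E_1}\frac{\gamma_2^2}{\gamma_1}\mathcal D_2,\quad \mathcal D_4=(\alpha\mathcal P)^2\Big(1+\frac{E_1\mathcal K^2}{\alpha\gamma_1}\mathcal D_3\Big),$$ $$C_1=\|\mathbf v_h^0\|^2+\frac{3C^2\mathcal D_3}{\nu\varrho}\|\mathbf u_h^0\|^2,\qquad C_2=\frac{9C^2\mathcal D_4}{\nu\varrho}.$$ **Claim.** (a) If $\dfrac{6C^2\mathcal D_4}{\nu\varrho}\Delta t\le1$, then for all $1\le n\le N$ $$\|\mathbf v_h^n\|^2+\sum_{i=1}^{n-1}\|\mathbf v_h^i-\mathbf v_h^{i-1}\|^2+\frac{\nu}{\varrho}\sum_{i=1}^n\Delta t\|\nabla\mathbf v_h^i\|^2+\frac{2\alpha}{\varrho}\sum_{i=1}^n\Delta t\|\mathbf v_h^i\|^2\le C_1\exp(C_2t_n).$$ (b) When $h^2\le\Delta t$, the constants are bounded independently of $h$ and $\Delta t$: there are $\mathcal D_3',\mathcal D_4',C_2'$ depending only on $\Omega$, $\mathcal P$, $\mathcal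 K$, $C$ and the parameters, and, for each $\mathbf u_0,\mathbf v_0$, a $C_1'$ depending in addition only on $\mathbf u_0,\mathbf v_0$, such that for every discretization and all $T,N$ as above with $h^2\le\Delta t$ one has $\mathcal D_3\le\mathcal D_3'$, $\mathcal D_4\le\mathcal D_4'$, $C_1\le C_1'$, $C_2\le C_2'$; in particular, under the restriction on $\Delta t$ in (a), the left-hand side in (a) is at most $C_1'\exp(C_2't_n)$. -/

import Mathlib

open MeasureTheory

noncomputable section

namespace PorousFlow

/-- Vectors of `ℝ^d` with the Euclidean norm. -/
abbrev Vec (d : ℕ) := EuclideanSpace ℝ (Fin d)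

/-- Real `d × d` matrices with the Frobenius inner product and norm. -/
abbrev Mat (d : ℕ) := EuclideanSpace ℝ (Fin d × Fin d)

/-- `L²(Ω)`. -/
abbrev L2S {d : ℕ} (Ω : Set (Vec d)) := Lp ℝ 2 (volume.restrict Ω)

/-- `L²(Ω)^d`. -/
abbrev L2V {d : ℕ} (Ω : Set (Vec d)) := Lp (Vec d) 2 (volume.restrict Ω)

/-- `L²(Ω)^{d×d}`; its norm is the `L²` norm of the Frobenius norm. -/
abbrev L2M {d : ℕ} (Ω : Set (Vec d)) := Lp (Mat d) 2 (volume.restrict Ω)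

/-- The classical gradient of a vector field, `(∇φ)_{ij} = ∂_j φ_i`. -/
def classicalGrad {d : ℕ} (φ : Vec d → Vec d) (x : Vec d) : Mat d :=
  WithLp.toLp 2 fun ij => fderiv ℝ φ x (EuclideanSpace.single ij.2 1) ij.1

/-- The pairs `(φ, ∇φ)` in `L²(Ω)^d × L²(Ω)^{d×d}`, with `φ` smooth and compactly supported
in `Ω`. -/
def testPairs {d : ℕ} (Ω : Set (Vec d)) : Submodule ℝ (L2V Ω × L2M Ω) where
  carrier := {w | ∃ φ : Vec d → Vec d, ContDiff ℝ (⊤ : ℕ∞) φ ∧ HasCompactSupport φ ∧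
    tsupport φ ⊆ Ω ∧ w.1 =ᵐ[volume.restrict Ω] φ ∧
    w.2 =ᵐ[volume.restrict Ω] classicalGrad φ}
  zero_mem' := by
    refine ⟨0, contDiff_const, HasCompactSupport.zero, ?_, Lp.coeFn_zero _ _ _, ?_⟩
    · simp [tsupport]
    · filter_upwards [Lp.coeFn_zero (Mat d) 2 (volume.restrict Ω)] with x hx
      rw [Prod.snd_zero, hx]
      ext ij
      simp [classicalGrad]
  add_mem' := by
    rintro a b ⟨φ, h1, h2, h3, h4, h5⟩ ⟨ψ, g1, g2, g3, g4, g5⟩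
    refine ⟨φ + ψ, h1.add g1, h2.add g2, ?_, ?_, ?_⟩
    · exact (tsupport_add φ ψ).trans (Set.union_subset h3 g3)
    · exact (Lp.coeFn_add a.1 b.1).trans (h4.add g4)
    · refine (Lp.coeFn_add a.2 b.2).trans ?_
      filter_upwards [h5, g5] with x hx gx
      rw [Pi.add_apply, hx, gx]
      ext ij
      simp [classicalGrad, fderiv_add (h1.differentiable (by simp) x)
        (g1.differentiable (by simp) x)]
  smul_mem' := by
    rintro c a ⟨φ, h1, h2, h3, h4, h5⟩
    refine ⟨c • φ, contDiff_const.smul h1, h2.smul_left, ?_, ?_, ?_⟩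
    · exact (closure_mono (Function.support_const_smul_subset c φ)).trans h3
    · exact (Lp.coeFn_smul c a.1).trans (h4.const_smul c)
    · refine (Lp.coeFn_smul c a.2).trans ?_
      filter_upwards [h5] with x hx
      rw [Pi.smul_apply, hx]
      ext ij
      simp [classicalGrad, fderiv_const_smul (h1.differentiable (by simp) x)]

/-- `H¹₀(Ω)^d`, the closure of the test fields in `H¹(Ω)^d`. A member is the pair of the field
and its weak gradient; the product topology is that of the `H¹` norm. -/
def H10 {d : ℕ} (Ω : Set (Vec d)) : Submodule ℝ (L2V Ω × L2M Ω) :=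
  (testPairs Ω).topologicalClosure

variable {d : ℕ} {Ω : Set (Vec d)}

/-- The field itself, as an element of `L²(Ω)^d`. -/
def fld (w : H10 Ω) : L2V Ω := w.1.1

/-- The weak gradient, `(∇w)_{ij} = ∂_j w_i`. -/
def grad (w : H10 Ω) : L2M Ω := w.1.2

/-- The linearized strain `ε(w) = (∇w + (∇w)ᵗ) / 2`. -/
def strain (w : H10 Ω) (x : Vec d) : Mat d :=
  WithLp.toLp 2 fun ij => (grad w x (ij.1, ij.2) + grad w x (ij.2, ij.1)) / 2

/-- The divergence. -/
def dvg (w : H10 Ω) (x : Vec d) : ℝ := ∑ i, grad w x (i, i)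

/-- `V`, the divergence-free fields of `H¹₀(Ω)^d`. -/
def divFree (Ω : Set (Vec d)) : Set (H10 Ω) :=
  {w | dvg w =ᵐ[volume.restrict Ω] 0}

/-- `P` is a constant of the Poincaré inequality on `H¹₀(Ω)^d`. -/
def IsPoincareConst (Ω : Set (Vec d)) (P : ℝ) : Prop :=
  0 < P ∧ ∀ w : H10 Ω, ‖fld w‖ ≤ P * ‖grad w‖

/-- `K` is a constant of the Korn inequality on `H¹₀(Ω)^d`. -/
def IsKornConst (Ω : Set (Vec d)) (K : ℝ) : Prop :=
  0 < K ∧ ∀ w : H10 Ω, ‖grad w‖ ≤ K * √(∫ x in Ω, ‖strain w x‖ ^ 2)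

/-- The truncation operator at level `r > 0`. -/
def trunc (r f : ℝ) : ℝ := if |f| ≤ r then f else r * Real.sign f

/-- The parameters: drag coefficient, viscosity, density, the elastic parameters
`E₁, E₂, λ₁, λ₂`, and the truncation level. -/
structure Params where
  α : ℝ
  ν : ℝ
  rho : ℝ
  E₁ : ℝ
  E₂ : ℝ
  lam₁ : ℝ
  lam₂ : ℝ
  δ : ℝ

namespace Params

variable (M : Params) (d : ℕ)

/-- `F(f) = E₁ (1 + λ₁ f) - d |E₂| (1 + λ₂ f)`. -/
def F (f : ℝ) : ℝ := M.E₁ * (1 + M.lam₁ * f) - d * |M.E₂| * (1 + M.lam₂ * f)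

def γ₁ : ℝ := 1 / (1 + |M.lam₁| * M.δ)
def γ₂ : ℝ := 1 / (1 - |M.lam₁| * M.δ)
def γ₃ : ℝ := M.E₁ + d * M.E₂
def γ₄ : ℝ := M.E₁ * M.lam₁ + d * M.E₂ * M.lam₂
def γ₅ : ℝ := 1 / (M.γ₃ d + |M.γ₄ d| * M.δ)
def γ₆ : ℝ := 1 / (M.γ₃ d - |M.γ₄ d| * M.δ)
def γ₇ : ℝ := 1 - |M.lam₂| * M.δ
def γ₈ : ℝ := 1 + |M.lam₂| * M.δ

def D₁ : ℝ := (M.γ₆ d * M.γ₈) ^ 2 / (M.γ₅ d * M.γ₇) * |M.E₂|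
def D₂ : ℝ := 1 + M.D₁ d / 2

/-- `D₃`, for the mesh size `h` and the time step `τ`. -/
def D₃ (h τ : ℝ) : ℝ :=
  (M.α * h) ^ 2 / τ + M.α / M.E₁ * (M.γ₂ ^ 2 / M.γ₁) * M.D₂ d

/-- `D₄`, for a Poincaré constant `P` and a Korn constant `K`. -/
def D₄ (P K h τ : ℝ) : ℝ :=
  (M.α * P) ^ 2 * (1 + M.E₁ * K ^ 2 / (M.α * M.γ₁) * M.D₃ d h τ)

/-- `C₁`; here `C` is the interpolation constant, and `u₀`, `v₀` stand for the `L²` norms of the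
discrete initial displacement and velocity. -/
def C₁ (C h τ u₀ v₀ : ℝ) : ℝ :=
  v₀ ^ 2 + 3 * C ^ 2 * M.D₃ d h τ / (M.ν * M.rho) * u₀ ^ 2

def C₂ (P K C h τ : ℝ) : ℝ := 9 * C ^ 2 * M.D₄ d P K h τ / (M.ν * M.rho)

end Params

/-- The spatial discretization with mesh size `h` and interpolation constant `C`: the discrete
spaces `U` (displacement) and `X` (velocity) in `H¹₀(Ω)^d` and `Q` (pressure) in `L²₀(Ω)`, with
interpolation operators `H¹₀(Ω)^d → U` and `V → V_h`, where
`V_h = {v ∈ X : ∫ q div v = 0 for all q ∈ Q}`. The operators need not be linear. -/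
structure Discretization (Ω : Set (Vec d)) (C : ℝ) where
  h : ℝ
  h_pos : 0 < h
  U : Submodule ℝ (H10 Ω)
  X : Submodule ℝ (H10 Ω)
  Q : Submodule ℝ (L2S Ω)
  finU : FiniteDimensional ℝ U
  finX : FiniteDimensional ℝ X
  finQ : FiniteDimensional ℝ Q
  mean_zero : ∀ q ∈ Q, ∫ x in Ω, q x = 0
  intU : H10 Ω → H10 Ω
  intU_mem : ∀ w, intU w ∈ U
  intU_stable : ∀ w, ‖grad (intU w)‖ ≤ C * ‖grad w‖
  intU_approx : ∀ w, ‖fld w - fld (intU w)‖ ≤ C * h * ‖grad w‖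
  intV : H10 Ω → H10 Ω
  intV_mem : ∀ w ∈ divFree Ω, intV w ∈ X ∧ ∀ q ∈ Q, ∫ x in Ω, q x * dvg (intV w) x = 0
  intV_stable : ∀ w ∈ divFree Ω, ‖grad (intV w)‖ ≤ C * ‖grad w‖
  intV_approx : ∀ w ∈ divFree Ω, ‖fld w - fld (intV w)‖ ≤ C * h * ‖grad w‖

/-- `V_h`, the discretely divergence-free velocities. -/
def Discretization.Vh {C : ℝ} (S : Discretization Ω C) : Set (H10 Ω) :=
  {v | v ∈ S.X ∧ ∀ q ∈ S.Q, ∫ x in Ω, q x * dvg v x = 0}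

/-- The displacement equation of one time step, from `uOld` to `u`, with velocity `v`. -/
def DisplacementStep (M : Params) (U : Submodule ℝ (H10 Ω)) (τ : ℝ) (uOld u v : H10 Ω) : Prop :=
  ∀ z ∈ U,
    M.α / τ * (∫ x in Ω, inner ℝ (fld u x - fld uOld x) (fld z x))
    + 1 / M.E₁ * (∫ x in Ω,
        1 / (1 + M.lam₁ * trunc M.δ (dvg uOld x)) * inner ℝ (strain u x) (strain z x))
    + |M.E₂| / M.E₁ * (∫ x in Ω,
        (1 + M.lam₂ * trunc M.δ (dvg uOld x)) / (1 + M.lam₁ * trunc M.δ (dvg uOld x))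
        * (1 / M.F d (trunc M.δ (dvg uOld x))) * (dvg u x * dvg z x))
    = M.α * (∫ x in Ω, inner ℝ (fld v x) (fld z x))

/-- The fluid equation of one time step, from `vOld` to `v`, with pressure `p`. -/
def FluidStep (M : Params) (X : Submodule ℝ (H10 Ω)) (τ : ℝ) (uOld u vOld v : H10 Ω)
    (p : L2S Ω) : Prop :=
  ∀ w ∈ X,
    M.rho / τ * (∫ x in Ω, inner ℝ (fld v x - fld vOld x) (fld w x))
    - (∫ x in Ω, p x * dvg w x)
    + M.ν * (∫ x in Ω, inner ℝ (grad v x) (grad w x))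
    + M.α * (∫ x in Ω, inner ℝ (fld v x) (fld w x))
    = M.α / τ * (∫ x in Ω, inner ℝ (fld u x - fld uOld x) (fld w x))

/-- `(u n, v n, p n)`, `n ≤ N`, is a solution of the fully discrete scheme with `N` steps of
length `τ` and initial data `u₀`, `v₀`. -/
structure IsDiscreteSolution (M : Params) {C : ℝ} (S : Discretization Ω C) (τ : ℝ) (N : ℕ)
    (u₀ v₀ : H10 Ω) (u v : ℕ → H10 Ω) (p : ℕ → L2S Ω) : Prop where
  init_u : u 0 = S.intU u₀
  init_v : v 0 = S.intV v₀
  mem_u : ∀ n ∈ Finset.Icc 1 N, u n ∈ S.U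
  mem_v : ∀ n ∈ Finset.Icc 1 N, v n ∈ S.Vh
  mem_p : ∀ n ∈ Finset.Icc 1 N, p n ∈ S.Q
  displacement : ∀ n ∈ Finset.Icc 1 N, DisplacementStep M S.U τ (u (n - 1)) (u n) (v n)
  fluid : ∀ n ∈ Finset.Icc 1 N,
    FluidStep M S.X τ (u (n - 1)) (u n) (v (n - 1)) (v n) (p n)

/-- The left-hand side of the stability bound at step `n ≥ 1`. -/
def velocityEnergy (M : Params) (τ : ℝ) (v : ℕ → H10 Ω) (n : ℕ) : ℝ :=
  ‖fld (v n)‖ ^ 2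
  + ∑ i ∈ Finset.Icc 1 (n - 1), ‖fld (v i) - fld (v (i - 1))‖ ^ 2
  + M.ν / M.rho * ∑ i ∈ Finset.Icc 1 n, τ * ‖grad (v i)‖ ^ 2
  + 2 * (M.α / M.rho) * ∑ i ∈ Finset.Icc 1 n, τ * ‖fld (v i)‖ ^ 2

end PorousFlow

end

open PorousFlow

noncomputable section

namespace PorousFlow

/-! ### Weighted integrals of `L²` functions -/

section LpTwo

variable {X E : Type*} [MeasurableSpace X] {μ : Measure X} [NormedAddCommGroup E]
  [InnerProductSpace ℝ E]

/-! The fluid equation is tested with `v` itself, which removes the pressure and leaves the drag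
term `α/τ (u - uOld, v)` on the right. Since `v` need not lie in the displacement space, it is split
into its interpolant and the interpolation error. The error costs `C h ‖∇v‖`; the interpolant is
admissible in the displacement equation, which trades the difference quotient for `α (v, Πv)` minus
the elastic stress tested with `Πv` (`fluid_energy`). Half of the viscous term absorbs `‖∇v‖`.

What remains is the increment of `u` and the stress. Testing the displacement equation with `u`
controls both: the increment by the implicit Euler square, the stress by the elastic dissipation
(`displacement_energy`, `stress_sq_le`). Adding this second estimate with weight `3 C² D₃ / (ν ρ)`
cancels them and leaves only a multiple of `τ ‖v‖²` (`step_energy`). The step-size restriction is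
exactly what `discrete_gronwall` needs to absorb it.

Uniformity in the discretization follows because `h² ≤ τ` bounds the only mesh-dependent term of
`D₃`, and because interpolation is stable in the gradient. The Poincaré constant comes from
integrating by parts against a coordinate. The Korn constant comes from an exact identity between
strain, gradient and divergence, which also gives `‖div w‖ ≤ ‖∇w‖`. -/

theorem Lp_norm_sq_eq_integral (f : Lp E 2 μ) : ‖f‖ ^ 2 = ∫ x, ‖f x‖ ^ 2 ∂μ := by
  rw [← real_inner_self_eq_norm_sq, L2.inner_def]
  simp_rw [real_inner_self_eq_norm_sq]

theorem integral_inner_sub_eq (f g k : Lp E 2 μ) :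
    ∫ x, inner ℝ (f x - g x) (k x) ∂μ = inner ℝ (f - g) k := by
  rw [L2.inner_def]
  refine integral_congr_ae ?_
  filter_upwards [Lp.coeFn_sub f g] with x hx
  rw [hx, Pi.sub_apply]

theorem abs_integral_weight_inner_le {a : X → ℝ} {A : ℝ} (ha : ∀ x, |a x| ≤ A)
    (f g : Lp E 2 μ) : |∫ x, a x * inner ℝ (f x) (g x) ∂μ| ≤ A * (‖f‖ * ‖g‖) := by
  have hf : MemLp (fun x => ‖f x‖) 2 μ := (Lp.memLp f).norm
  have hg : MemLp (fun x => ‖g x‖) 2 μ := (Lp.memLp g).norm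
  have hsq : ∀ k : Lp E 2 μ, (∫ x, ‖k x‖ ^ (2 : ℝ) ∂μ) ^ (1 / (2 : ℝ)) = ‖k‖ := fun k => by
    simp_rw [Real.rpow_two]
    rw [← Lp_norm_sq_eq_integral, ← Real.sqrt_eq_rpow, Real.sqrt_sq (norm_nonneg _)]
  have hint : Integrable (fun x => ‖f x‖ * ‖g x‖) μ := hf.integrable_mul hg
  have h1 : |∫ x, a x * inner ℝ (f x) (g x) ∂μ| ≤ ∫ x, A * (‖f x‖ * ‖g x‖) ∂μ := by
    rw [← Real.norm_eq_abs]
    refine norm_integral_le_of_norm_le (hint.const_mul A) (Filter.Eventually.of_forall fun x => ?_)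
    rw [norm_mul]
    exact mul_le_mul (ha x) (abs_real_inner_le_norm _ _) (norm_nonneg _) ((abs_nonneg _).trans (ha x))
  refine h1.trans ?_
  rw [integral_const_mul]
  -- `0 ≤ A` is read off from `ha` at a point, so the empty space needs its own case.
  by_cases hX : Nonempty X
  · have hA : 0 ≤ A := (abs_nonneg _).trans (ha hX.some)
    refine mul_le_mul_of_nonneg_left ?_ hA
    have := integral_mul_le_Lp_mul_Lq_of_nonneg (μ := μ) (Real.HolderConjugate.two_two)
      (f := fun x => ‖f x‖) (g := fun x => ‖g x‖)
      (Filter.Eventually.of_forall fun x => norm_nonneg _)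
      (Filter.Eventually.of_forall fun x => norm_nonneg _) (by simpa using hf) (by simpa using hg)
    rwa [hsq, hsq] at this
  · have : IsEmpty X := not_nonempty_iff.mp hX
    have h0 : ‖f‖ ^ 2 = 0 := by rw [Lp_norm_sq_eq_integral]; simp [Measure.eq_zero_of_isEmpty μ]
    have : ‖f‖ = 0 := by simpa using h0
    rw [this]
    simp [Measure.eq_zero_of_isEmpty μ]

theorem le_integral_weight_inner_self {a : X → ℝ} {A B : ℝ} (hA : ∀ x, A ≤ a x)
    (hB : ∀ x, |a x| ≤ B) (hm : AEStronglyMeasurable a μ) (f : Lp E 2 μ) :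
    A * ‖f‖ ^ 2 ≤ ∫ x, a x * inner ℝ (f x) (f x) ∂μ := by
  have hf : Integrable (fun x => (inner ℝ (f x) (f x) : ℝ)) μ := L2.integrable_inner f f
  rw [← real_inner_self_eq_norm_sq, L2.inner_def, ← integral_const_mul]
  refine integral_mono (hf.const_mul A)
    (hf.bdd_mul hm (Filter.Eventually.of_forall hB)) fun x => ?_
  exact mul_le_mul_of_nonneg_right (hA x) real_inner_self_nonneg

end LpTwo

/-! ### Integration by parts for smooth scalar functions -/

section Scalar

variable {d : ℕ}

/-- The partial derivative `∂_i f`. -/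
def pd (i : Fin d) (f : Vec d → ℝ) (x : Vec d) : ℝ := fderiv ℝ f x (EuclideanSpace.single i 1)

theorem contDiff_pd {f : Vec d → ℝ} (hf : ContDiff ℝ (⊤ : ℕ∞) f) (i : Fin d) :
    ContDiff ℝ (⊤ : ℕ∞) (pd i f) :=
  (hf.fderiv_right (by simp)).clm_apply contDiff_const

theorem hasCompactSupport_pd {f : Vec d → ℝ} (hf : HasCompactSupport f) (i : Fin d) :
    HasCompactSupport (pd i f) :=
  hf.fderiv_apply (𝕜 := ℝ) (EuclideanSpace.single i 1)

theorem pd_comm {f : Vec d → ℝ} (hf : ContDiff ℝ (⊤ : ℕ∞) f) (i j : Fin d) :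
    pd i (pd j f) = pd j (pd i f) := by
  have h2 : ∀ x, DifferentiableAt ℝ (fderiv ℝ f) x := fun x =>
    (hf.fderiv_right (m := (⊤ : ℕ∞)) (by simp)).differentiable (by simp) x
  have key : ∀ (a b : Fin d) (x : Vec d), pd a (pd b f) x
      = fderiv ℝ (fderiv ℝ f) x (EuclideanSpace.single a 1) (EuclideanSpace.single b 1) := by
    intro a b x
    unfold pd
    rw [fderiv_clm_apply (h2 x) (by fun_prop)]
    simp
  funext x
  rw [key, key]
  refine ContDiffAt.isSymmSndFDerivAt (n := (⊤ : ℕ∞)) hf.contDiffAt ?_ _ _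
  rw [minSmoothness_of_isRCLikeNormedField]
  exact WithTop.coe_le_coe.2 (le_top : (2 : ℕ∞) ≤ ⊤)

theorem integral_mul_pd {f g : Vec d → ℝ} (hf : ContDiff ℝ (⊤ : ℕ∞) f)
    (hg : ContDiff ℝ (⊤ : ℕ∞) g) (hc : HasCompactSupport f) (i : Fin d) :
    ∫ x, f x * pd i g x = - ∫ x, pd i f x * g x := by
  have hf' := contDiff_pd hf i
  have hg' := contDiff_pd hg i
  refine integral_mul_fderiv_eq_neg_fderiv_mul_of_integrable ?_ ?_ ?_
    (fun x _ => hf.differentiable (by simp) x) (fun x _ => hg.differentiable (by simp) x)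
  · exact (hf'.continuous.mul hg.continuous).integrable_of_hasCompactSupport
      (hasCompactSupport_pd hc i).mul_right
  · exact (hf.continuous.mul hg'.continuous).integrable_of_hasCompactSupport hc.mul_right
  · exact (hf.continuous.mul hg.continuous).integrable_of_hasCompactSupport hc.mul_right

/-- Both sides equal `-∫ f ∂ᵢ∂ⱼg`: move the derivative off `f` and use symmetry of second
derivatives. -/
theorem integral_pd_mul_pd_comm {f g : Vec d → ℝ} (hf : ContDiff ℝ (⊤ : ℕ∞) f)
    (hg : ContDiff ℝ (⊤ : ℕ∞) g) (hc : HasCompactSupport f) (i j : Fin d) :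
    ∫ x, pd j f x * pd i g x = ∫ x, pd i f x * pd j g x := by
  have h1 := integral_mul_pd hf (contDiff_pd hg i) hc j
  have h2 := integral_mul_pd hf (contDiff_pd hg j) hc i
  rw [pd_comm hg j i] at h1
  linarith

/-- Since `∂ᵢxᵢ = 1`, integrating `f² ∂ᵢxᵢ` by parts gives `∫ f² = -2 ∫ f ∂ᵢf xᵢ`. Young's
inequality with `|xᵢ| ≤ R` on the support then lets half of `∫ f²` be absorbed. -/
theorem integral_sq_le_of_support_bounded {f : Vec d → ℝ} (hf : ContDiff ℝ (⊤ : ℕ∞) f)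
    (hc : HasCompactSupport f) (i : Fin d) {R : ℝ} (hR : ∀ x ∈ tsupport f, ‖x‖ ≤ R) :
    ∫ x, f x ^ 2 ≤ (2 * R) ^ 2 * ∫ x, pd i f x ^ 2 := by
  have hx : ContDiff ℝ (⊤ : ℕ∞) (fun x : Vec d => x i) :=
    (EuclideanSpace.proj (𝕜 := ℝ) i).contDiff
  have hpx : ∀ x, pd i (fun x : Vec d => x i) x = 1 := by
    intro x
    have : fderiv ℝ (fun x : Vec d => x i) x = EuclideanSpace.proj (𝕜 := ℝ) i :=
      (EuclideanSpace.proj (𝕜 := ℝ) i).fderiv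
    simp [pd, this]
  have hpf : ∀ x, pd i (fun x => f x ^ 2) x = 2 * f x * pd i f x := by
    intro x
    have := fderiv_fun_pow (𝕜 := ℝ) (f := f) (x := x) 2 (hf.differentiable (by simp) x)
    simp [pd, this]
  have hf' := contDiff_pd hf i
  have hc' := hasCompactSupport_pd hc i
  have hsupp : HasCompactSupport (fun x => f x ^ 2) := by
    simp only [sq]; exact hc.mul_right
  have hsupp' : HasCompactSupport (fun x => pd i f x ^ 2) := by
    simp only [sq]; exact hc'.mul_right
  have hI := (hf.pow 2).continuous.integrable_of_hasCompactSupport (μ := volume) hsupp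
  have hI' := (hf'.pow 2).continuous.integrable_of_hasCompactSupport (μ := volume) hsupp'
  have h1 := integral_mul_pd (hf.pow 2) hx hsupp i
  simp only [hpx, mul_one, hpf] at h1
  have h2 : -∫ x, 2 * f x * pd i f x * x i
      ≤ ∫ x, (1 / 2 * f x ^ 2 + 2 * R ^ 2 * pd i f x ^ 2) := by
    rw [← integral_neg]
    refine integral_mono ?_ ((hI.const_mul _).add (hI'.const_mul _)) fun x => ?_
    · refine Continuous.integrable_of_hasCompactSupport ?_ ?_
      · exact (((continuous_const.mul hf.continuous).mul hf'.continuous).mul hx.continuous).neg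
      · refine HasCompactSupport.neg ?_
        exact ((hc.mul_left (f := fun _ => (2 : ℝ))).mul_right).mul_right
    · by_cases hxs : x ∈ tsupport f
      · have hxi : |x i| ≤ R := (PiLp.norm_apply_le x i).trans (hR x hxs)
        have hsq : (x i) ^ 2 ≤ R ^ 2 := sq_le_sq' (abs_le.1 hxi).1 (abs_le.1 hxi).2
        have := mul_le_mul_of_nonneg_right hsq (sq_nonneg (pd i f x))
        dsimp only
        nlinarith [sq_nonneg (f x + 2 * (pd i f x * x i))]
      · have : f x = 0 := image_eq_zero_of_notMem_tsupport hxs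
        simp only [this]
        simp only [mul_zero, zero_mul, neg_zero]
        positivity
  rw [integral_add (hI.const_mul _) (hI'.const_mul _), integral_const_mul, integral_const_mul] at h2
  nlinarith

end Scalar

/-! ### Poincaré and Korn inequalities -/

section Sobolev

variable {d : ℕ} {Ω : Set (Vec d)}

/-- The symmetric part of a matrix. -/
def symL (d : ℕ) : Mat d →L[ℝ] Mat d :=
  LinearMap.toContinuousLinearMap
    { toFun := fun A => WithLp.toLp 2 fun ij => (A (ij.1, ij.2) + A (ij.2, ij.1)) / 2
      map_add' := fun A B => by ext ij; simp; ring
      map_smul' := fun c A => by ext ij; simp; ring }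

/-- The trace of a matrix. -/
def trL (d : ℕ) : Mat d →L[ℝ] ℝ :=
  LinearMap.toContinuousLinearMap
    { toFun := fun A => ∑ i, A (i, i)
      map_add' := fun A B => by simp [Finset.sum_add_distrib]
      map_smul' := fun c A => by simp [Finset.mul_sum] }

theorem symL_apply (A : Mat d) (i j : Fin d) : symL d A (i, j) = (A (i, j) + A (j, i)) / 2 := rfl

theorem trL_apply (A : Mat d) : trL d A = ∑ i, A (i, i) := rfl

/-- The right side is written as a null Lagrangian: for `A = ∇φ` each summand integrates to zero, by
`integral_pd_mul_pd_comm`. This is the source of Korn's inequality. -/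
theorem two_mul_norm_symL_sq (A : Mat d) :
    2 * ‖symL d A‖ ^ 2 - ‖A‖ ^ 2 - ‖trL d A‖ ^ 2
      = ∑ i, ∑ j, (A (i, j) * A (j, i) - A (i, i) * A (j, j)) := by
  rw [EuclideanSpace.real_norm_sq_eq, EuclideanSpace.real_norm_sq_eq, Fintype.sum_prod_type,
    Fintype.sum_prod_type, Real.norm_eq_abs, sq_abs, trL_apply, sq, Finset.sum_mul_sum]
  have hswap : ∑ i, ∑ j, A (j, i) ^ 2 = ∑ i, ∑ j, A (i, j) ^ 2 := Finset.sum_comm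
  have hsym : 2 * ∑ i, ∑ j, symL d A (i, j) ^ 2
      = 1 / 2 * ∑ i, ∑ j, A (i, j) ^ 2 + 1 / 2 * ∑ i, ∑ j, A (j, i) ^ 2
        + ∑ i, ∑ j, A (i, j) * A (j, i) := by
    simp only [Finset.mul_sum, ← Finset.sum_add_distrib, symL_apply]
    refine Finset.sum_congr rfl fun i _ => Finset.sum_congr rfl fun j _ => ?_
    ring
  rw [hsym, hswap]
  simp only [Finset.sum_sub_distrib]
  ring

theorem classicalGrad_apply {φ : Vec d → Vec d} (hφ : ContDiff ℝ (⊤ : ℕ∞) φ) (x : Vec d)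
    (i j : Fin d) : classicalGrad φ x (i, j) = pd j (fun y => φ y i) x := by
  have h := (EuclideanSpace.proj (𝕜 := ℝ) i).hasFDerivAt.comp x
    (hφ.differentiable (by simp) x).hasFDerivAt
  have h' : fderiv ℝ (fun y => φ y i) x
      = (EuclideanSpace.proj (𝕜 := ℝ) i).comp (fderiv ℝ φ x) := h.fderiv
  simp [classicalGrad, pd, h']

theorem contDiff_component {φ : Vec d → Vec d} (hφ : ContDiff ℝ (⊤ : ℕ∞) φ) (i : Fin d) :
    ContDiff ℝ (⊤ : ℕ∞) (fun y => φ y i) :=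
  (EuclideanSpace.proj (𝕜 := ℝ) i).contDiff.comp hφ

theorem tsupport_component_subset (φ : Vec d → Vec d) (i : Fin d) :
    tsupport (fun y => φ y i) ⊆ tsupport φ := by
  refine closure_mono fun x hx => ?_
  contrapose! hx
  simp only [Function.mem_support, not_not] at hx ⊢
  simp [hx]

theorem hasCompactSupport_component {φ : Vec d → Vec d} (hc : HasCompactSupport φ) (i : Fin d) :
    HasCompactSupport (fun y => φ y i) :=
  IsCompact.of_isClosed_subset hc (isClosed_tsupport _) (tsupport_component_subset φ i)

theorem classicalGrad_eq_zero {φ : Vec d → Vec d} (h : tsupport φ ⊆ Ω) {x : Vec d} (hx : x ∉ Ω) :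
    classicalGrad φ x = 0 := by
  have : fderiv ℝ φ x = 0 := by
    by_contra h0
    exact hx (h (support_fderiv_subset ℝ h0))
  ext ij
  simp [classicalGrad, this]

theorem integral_two_mul_norm_symL_classicalGrad {φ : Vec d → Vec d}
    (hφ : ContDiff ℝ (⊤ : ℕ∞) φ) (hc : HasCompactSupport φ) (hs : tsupport φ ⊆ Ω) :
    ∫ x in Ω, (2 * ‖symL d (classicalGrad φ x)‖ ^ 2 - ‖classicalGrad φ x‖ ^ 2
      - ‖trL d (classicalGrad φ x)‖ ^ 2) = 0 := by
  rw [setIntegral_eq_integral_of_forall_compl_eq_zero fun x hx => by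
    simp [classicalGrad_eq_zero hs hx]]
  simp_rw [two_mul_norm_symL_sq, classicalGrad_apply hφ]
  have hcd := contDiff_component hφ
  have hcs := hasCompactSupport_component hc
  have hint : ∀ i j k l : Fin d,
      Integrable (fun x => pd k (fun y => φ y i) x * pd l (fun y => φ y j) x) := fun i j k l =>
    ((contDiff_pd (hcd i) k).continuous.mul
      (contDiff_pd (hcd j) l).continuous).integrable_of_hasCompactSupport
        (hasCompactSupport_pd (hcs i) k).mul_right
  have hdiff : ∀ i j : Fin d, Integrable fun x =>
      pd j (fun y => φ y i) x * pd i (fun y => φ y j) x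
        - pd i (fun y => φ y i) x * pd j (fun y => φ y j) x := fun i j =>
    (hint i j j i).sub (hint i j i j)
  rw [integral_finsetSum _ fun i _ => integrable_finsetSum _ fun j _ => hdiff i j]
  refine Finset.sum_eq_zero fun i _ => ?_
  rw [integral_finsetSum _ fun j _ => hdiff i j]
  refine Finset.sum_eq_zero fun j _ => ?_
  rw [integral_sub (hint i j j i) (hint i j i j),
    integral_pd_mul_pd_comm (hcd i) (hcd j) (hcs i) i j, sub_self]

theorem integrable_norm_sq {E : Type*} [NormedAddCommGroup E] {X : Type*} [MeasurableSpace X]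
    {μ : Measure X} (f : Lp E 2 μ) : Integrable (fun x => ‖f x‖ ^ 2) μ :=
  (Lp.memLp f).norm.integrable_sq

/-- The symmetric part of an `L²` matrix field. -/
def symLp (Ω : Set (Vec d)) : L2M Ω →L[ℝ] L2M Ω := (symL d).compLpL 2 (volume.restrict Ω)

/-- The trace of an `L²` matrix field. -/
def trLp (Ω : Set (Vec d)) : L2M Ω →L[ℝ] L2S Ω := (trL d).compLpL 2 (volume.restrict Ω)

theorem two_mul_norm_symLp_sq_of_mem_testPairs {w : L2V Ω × L2M Ω} (hw : w ∈ testPairs Ω) :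
    2 * ‖symLp Ω w.2‖ ^ 2 = ‖w.2‖ ^ 2 + ‖trLp Ω w.2‖ ^ 2 := by
  obtain ⟨φ, hφ, hc, hs, -, hg⟩ := hw
  have h := integral_two_mul_norm_symL_classicalGrad hφ hc hs
  have h1 := integrable_norm_sq (symLp Ω w.2)
  have h2 := integrable_norm_sq w.2
  have h3 := integrable_norm_sq (trLp Ω w.2)
  have h4 : ∫ x in Ω, (2 * ‖symLp Ω w.2 x‖ ^ 2 - ‖w.2 x‖ ^ 2 - ‖trLp Ω w.2 x‖ ^ 2) = 0 := by
    rw [← h]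
    refine integral_congr_ae ?_
    filter_upwards [hg, (symL d).coeFn_compLpL (p := 2) w.2, (trL d).coeFn_compLpL (p := 2) w.2]
      with x hx hx1 hx2
    rw [symLp, trLp, hx1, hx2, hx]
  have h12 : Integrable (fun x => 2 * ‖symLp Ω w.2 x‖ ^ 2 - ‖w.2 x‖ ^ 2) (volume.restrict Ω) :=
    (h1.const_mul 2).sub h2
  rw [integral_sub h12 h3, integral_sub (h1.const_mul 2) h2,
    integral_const_mul, ← Lp_norm_sq_eq_integral, ← Lp_norm_sq_eq_integral,
    ← Lp_norm_sq_eq_integral] at h4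
  linarith

/-- Both sides are continuous in the `H¹` topology, so the identity passes from test fields to their
closure. -/
theorem two_mul_norm_symLp_grad_sq (w : H10 Ω) :
    2 * ‖symLp Ω (grad w)‖ ^ 2 = ‖grad w‖ ^ 2 + ‖trLp Ω (grad w)‖ ^ 2 := by
  have hcl : IsClosed {w : L2V Ω × L2M Ω |
      2 * ‖symLp Ω w.2‖ ^ 2 = ‖w.2‖ ^ 2 + ‖trLp Ω w.2‖ ^ 2} :=
    isClosed_eq (by fun_prop) (by fun_prop)
  exact closure_minimal (fun w hw => two_mul_norm_symLp_sq_of_mem_testPairs hw) hcl w.2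

theorem norm_sq_le_of_mem_testPairs (hd : 0 < d) {R : ℝ} (hR : ∀ x ∈ Ω, ‖x‖ ≤ R)
    {w : L2V Ω × L2M Ω} (hw : w ∈ testPairs Ω) : ‖w.1‖ ^ 2 ≤ (2 * R) ^ 2 * ‖w.2‖ ^ 2 := by
  obtain ⟨φ, hφ, hc, hs, hf, hg⟩ := hw
  have hcd := contDiff_component hφ
  have hcs := hasCompactSupport_component hc
  have hsq : ∀ {f : Vec d → ℝ}, ContDiff ℝ (⊤ : ℕ∞) f → HasCompactSupport f →
      Integrable (fun x => f x ^ 2) := fun hf hc =>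
    (hf.pow 2).continuous.integrable_of_hasCompactSupport (by simp only [sq]; exact hc.mul_right)
  have e1 : ‖w.1‖ ^ 2 = ∑ i, ∫ x, φ x i ^ 2 := by
    rw [Lp_norm_sq_eq_integral, integral_congr_ae (g := fun x => ‖φ x‖ ^ 2)
      (by filter_upwards [hf] with x hx; rw [hx]),
      setIntegral_eq_integral_of_forall_compl_eq_zero fun x hx => by
        rw [image_eq_zero_of_notMem_tsupport fun h => hx (hs h)]; simp]
    simp_rw [EuclideanSpace.real_norm_sq_eq]
    exact integral_finsetSum _ fun i _ => hsq (hcd i) (hcs i)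
  have e2 : ‖w.2‖ ^ 2 = ∑ i, ∑ j, ∫ x, pd j (fun y => φ y i) x ^ 2 := by
    rw [Lp_norm_sq_eq_integral, integral_congr_ae (g := fun x => ‖classicalGrad φ x‖ ^ 2)
      (by filter_upwards [hg] with x hx; rw [hx]),
      setIntegral_eq_integral_of_forall_compl_eq_zero fun x hx => by
        simp [classicalGrad_eq_zero hs hx]]
    simp_rw [EuclideanSpace.real_norm_sq_eq, Fintype.sum_prod_type, classicalGrad_apply hφ]
    have hint := fun i j : Fin d => hsq (contDiff_pd (hcd i) j) (hasCompactSupport_pd (hcs i) j)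
    rw [integral_finsetSum _ fun i _ => integrable_finsetSum _ fun j _ => hint i j]
    exact Finset.sum_congr rfl fun i _ => integral_finsetSum _ fun j _ => hint i j
  rw [e1, e2, Finset.mul_sum]
  refine Finset.sum_le_sum fun i _ => ?_
  -- A single direction of differentiation suffices; the other partial derivatives only enlarge the
  -- right side.
  refine (integral_sq_le_of_support_bounded (hcd i) (hcs i) ⟨0, hd⟩ fun x hx =>
    hR x (hs (tsupport_component_subset φ i hx))).trans ?_
  refine mul_le_mul_of_nonneg_left ?_ (sq_nonneg _)
  exact Finset.single_le_sum (f := fun j => ∫ x, pd j (fun y => φ y i) x ^ 2)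
    (fun j _ => integral_nonneg fun x => sq_nonneg _) (Finset.mem_univ _)

theorem exists_isPoincareConst (hd : 0 < d) (hΩb : Bornology.IsBounded Ω) :
    ∃ P, IsPoincareConst Ω P := by
  obtain ⟨R, hR0, hR⟩ := hΩb.exists_pos_norm_le
  refine ⟨2 * R, by positivity, fun w => ?_⟩
  have hcl : IsClosed {w : L2V Ω × L2M Ω | ‖w.1‖ ^ 2 ≤ (2 * R) ^ 2 * ‖w.2‖ ^ 2} :=
    isClosed_le (by fun_prop) (by fun_prop)
  have h : ‖fld w‖ ^ 2 ≤ (2 * R) ^ 2 * ‖grad w‖ ^ 2 :=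
    closure_minimal (fun w hw => norm_sq_le_of_mem_testPairs hd hR hw) hcl w.2
  rw [← mul_pow] at h
  exact le_of_sq_le_sq h (by positivity)

theorem symLp_grad_ae (w : H10 Ω) : symLp Ω (grad w) =ᵐ[volume.restrict Ω] strain w :=
  (symL d).coeFn_compLpL (p := 2) (grad w)

theorem trLp_grad_ae (w : H10 Ω) : trLp Ω (grad w) =ᵐ[volume.restrict Ω] dvg w :=
  (trL d).coeFn_compLpL (p := 2) (grad w)

theorem sqrt_integral_norm_strain_sq (w : H10 Ω) :
    √(∫ x in Ω, ‖strain w x‖ ^ 2) = ‖symLp Ω (grad w)‖ := by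
  rw [← integral_congr_ae (f := fun x => ‖symLp Ω (grad w) x‖ ^ 2)
    (by filter_upwards [symLp_grad_ae w] with x hx; rw [hx]), ← Lp_norm_sq_eq_integral,
    Real.sqrt_sq (norm_nonneg _)]

/-- The constant `√2` results from discarding the divergence term of the identity. -/
theorem exists_isKornConst : ∃ K, IsKornConst Ω K := by
  refine ⟨√2, by positivity, fun w => ?_⟩
  rw [sqrt_integral_norm_strain_sq]
  refine le_of_sq_le_sq ?_ (by positivity)
  rw [mul_pow, Real.sq_sqrt (by norm_num), two_mul_norm_symLp_grad_sq]
  exact le_add_of_nonneg_right (sq_nonneg _)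

theorem norm_symL_le (A : Mat d) : ‖symL d A‖ ≤ ‖A‖ := by
  refine le_of_sq_le_sq ?_ (norm_nonneg _)
  rw [EuclideanSpace.real_norm_sq_eq, EuclideanSpace.real_norm_sq_eq, Fintype.sum_prod_type,
    Fintype.sum_prod_type]
  have hswap : ∑ i, ∑ j, A (j, i) ^ 2 = ∑ i, ∑ j, A (i, j) ^ 2 := Finset.sum_comm
  have : ∑ i, ∑ j, symL d A (i, j) ^ 2
      ≤ 1 / 2 * ∑ i, ∑ j, A (i, j) ^ 2 + 1 / 2 * ∑ i, ∑ j, A (j, i) ^ 2 := by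
    simp only [Finset.mul_sum, ← Finset.sum_add_distrib, symL_apply]
    refine Finset.sum_le_sum fun i _ => Finset.sum_le_sum fun j _ => ?_
    nlinarith [sq_nonneg (A (i, j) - A (j, i))]
  linarith

theorem norm_symLp_le (G : L2M Ω) : ‖symLp Ω G‖ ≤ ‖G‖ := by
  refine Lp.norm_le_norm_of_ae_le ?_
  filter_upwards [(symL d).coeFn_compLpL (p := 2) G] with x hx
  rw [symLp, hx]
  exact norm_symL_le _

/-- Pointwise the trace is bounded only by `√d` times the Frobenius norm. The constant `1` is a
global effect of the zero boundary values, obtained from the identity and `‖ε(w)‖ ≤ ‖∇w‖`; it keeps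
a factor `√d` out of the stress bound. -/
theorem norm_trLp_grad_le (w : H10 Ω) : ‖trLp Ω (grad w)‖ ≤ ‖grad w‖ := by
  refine le_of_sq_le_sq ?_ (norm_nonneg _)
  have h1 := two_mul_norm_symLp_grad_sq w
  have h2 := pow_le_pow_left₀ (norm_nonneg _) (norm_symLp_le (grad w)) 2
  linarith

end Sobolev

/-! ### Bounds for the truncated coefficients -/

section Coefficients

/-- The smallness and sign assumptions on the parameters. -/
structure Params.Admissible (M : Params) (d : ℕ) : Prop where
  α_pos : 0 < M.α
  ν_pos : 0 < M.ν
  rho_pos : 0 < M.rho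
  E₁_pos : 0 < M.E₁
  E₂_neg : M.E₂ < 0
  δ_pos : 0 < M.δ
  small₁ : 0 < 1 - |M.lam₁| * M.δ
  small₂ : 0 < M.γ₃ d - |M.γ₄ d| * M.δ
  small₃ : 0 < 1 - |M.lam₂| * M.δ

/-- The clamp form makes boundedness and measurability immediate. -/
theorem trunc_eq {r : ℝ} (hr : 0 < r) (f : ℝ) : trunc r f = max (-r) (min r f) := by
  unfold trunc
  split_ifs with h
  · rw [min_eq_right (abs_le.1 h).2, max_eq_right (abs_le.1 h).1]
  · rcases lt_abs.1 (not_le.1 h) with h | h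
    · rw [Real.sign_of_pos (hr.trans h), min_eq_left h.le, max_eq_right (by linarith), mul_one]
    · rw [Real.sign_of_neg (by linarith), min_eq_right (by linarith), max_eq_left (by linarith)]
      ring

theorem abs_trunc_le {r : ℝ} (hr : 0 < r) (f : ℝ) : |trunc r f| ≤ r := by
  rw [trunc_eq hr, abs_le]
  exact ⟨le_max_left _ _, max_le (by linarith) (min_le_left _ _)⟩

theorem measurable_trunc {r : ℝ} (hr : 0 < r) : Measurable (trunc r) := by
  rw [funext (trunc_eq hr)]
  fun_prop

namespace Params.Admissible

variable {M : Params} {d : ℕ} (hM : M.Admissible d)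
include hM

theorem γ₁_pos : 0 < M.γ₁ := by
  have := hM.δ_pos
  unfold Params.γ₁
  positivity

theorem γ₂_pos : 0 < M.γ₂ := one_div_pos.2 hM.small₁

theorem γ₅_pos : 0 < M.γ₅ d := by
  have h1 := hM.small₂
  have h2 : 0 ≤ |M.γ₄ d| * M.δ := mul_nonneg (abs_nonneg _) hM.δ_pos.le
  exact one_div_pos.2 (by linarith)

theorem γ₆_pos : 0 < M.γ₆ d := one_div_pos.2 hM.small₂

theorem γ₇_pos : 0 < M.γ₇ := hM.small₃

theorem γ₈_pos : 0 < M.γ₈ := by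
  have := hM.δ_pos
  unfold Params.γ₈
  positivity

theorem D₁_nonneg : 0 ≤ M.D₁ d := by
  have := hM.γ₅_pos
  have := hM.γ₇_pos
  unfold Params.D₁
  positivity

theorem D₂_pos : 0 < M.D₂ d := by
  have := hM.D₁_nonneg
  unfold Params.D₂
  positivity

theorem D₃_pos (h : ℝ) {τ : ℝ} (hτ : 0 < τ) : 0 < M.D₃ d h τ := by
  have := hM.α_pos
  have := hM.E₁_pos
  have := hM.γ₁_pos
  have := hM.γ₂_pos
  have := hM.D₂_pos
  unfold Params.D₃
  positivity

theorem D₄_nonneg (P K h : ℝ) {τ : ℝ} (hτ : 0 < τ) : 0 ≤ M.D₄ d P K h τ := by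
  have := hM.α_pos
  have := hM.E₁_pos
  have := hM.γ₁_pos
  have := hM.D₃_pos h hτ
  unfold Params.D₄
  positivity

omit hM in
theorem abs_mul_le_of_abs_le {l f r : ℝ} (hf : |f| ≤ r) : |l * f| ≤ |l| * r := by
  rw [abs_mul]
  exact mul_le_mul_of_nonneg_left hf (abs_nonneg _)

theorem F_eq (f : ℝ) : M.F d f = M.γ₃ d + M.γ₄ d * f := by
  rw [Params.F, Params.γ₃, Params.γ₄, abs_of_neg hM.E₂_neg]
  ring

theorem le_coeff₁ {f : ℝ} (hf : |f| ≤ M.δ) : M.γ₁ ≤ 1 / (1 + M.lam₁ * f) := by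
  have h := abs_le.1 (abs_mul_le_of_abs_le (l := M.lam₁) hf)
  have h1 := hM.small₁
  exact one_div_le_one_div_of_le (by linarith) (by linarith)

theorem coeff₁_le {f : ℝ} (hf : |f| ≤ M.δ) : 1 / (1 + M.lam₁ * f) ≤ M.γ₂ := by
  have h := abs_le.1 (abs_mul_le_of_abs_le (l := M.lam₁) hf)
  exact one_div_le_one_div_of_le hM.small₁ (by linarith)

theorem le_one_div_F {f : ℝ} (hf : |f| ≤ M.δ) : M.γ₅ d ≤ 1 / M.F d f := by
  have h := abs_le.1 (abs_mul_le_of_abs_le (l := M.γ₄ d) hf)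
  have h1 := hM.small₂
  rw [hM.F_eq]
  exact one_div_le_one_div_of_le (by linarith) (by linarith)

theorem one_div_F_le {f : ℝ} (hf : |f| ≤ M.δ) : 1 / M.F d f ≤ M.γ₆ d := by
  have h := abs_le.1 (abs_mul_le_of_abs_le (l := M.γ₄ d) hf)
  rw [hM.F_eq]
  exact one_div_le_one_div_of_le hM.small₂ (by linarith)

theorem le_coeff₂ {f : ℝ} (hf : |f| ≤ M.δ) :
    M.γ₇ * M.γ₁ * M.γ₅ d ≤ (1 + M.lam₂ * f) / (1 + M.lam₁ * f) * (1 / M.F d f) := by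
  have h := abs_le.1 (abs_mul_le_of_abs_le (l := M.lam₂) hf)
  have h7 := hM.γ₇_pos
  have h1 := hM.γ₁_pos
  have h5 := hM.γ₅_pos
  have h78 : M.γ₇ ≤ 1 + M.lam₂ * f := by unfold Params.γ₇; linarith
  have hc := hM.le_coeff₁ hf
  rw [div_eq_mul_one_div (1 + M.lam₂ * f)]
  exact mul_le_mul (mul_le_mul h78 hc h1.le (h7.le.trans h78)) (hM.le_one_div_F hf) h5.le
    (mul_nonneg (h7.le.trans h78) (h1.le.trans hc))

theorem coeff₂_le {f : ℝ} (hf : |f| ≤ M.δ) :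
    (1 + M.lam₂ * f) / (1 + M.lam₁ * f) * (1 / M.F d f) ≤ M.γ₈ * M.γ₂ * M.γ₆ d := by
  have h := abs_le.1 (abs_mul_le_of_abs_le (l := M.lam₂) hf)
  have h8 := hM.γ₈_pos
  have h2 := hM.γ₂_pos
  have h78 : 1 + M.lam₂ * f ≤ M.γ₈ := by unfold Params.γ₈; linarith
  rw [div_eq_mul_one_div (1 + M.lam₂ * f)]
  exact mul_le_mul (mul_le_mul h78 (hM.coeff₁_le hf) (hM.γ₁_pos.le.trans (hM.le_coeff₁ hf)) h8.le)
    (hM.one_div_F_le hf) (hM.γ₅_pos.le.trans (hM.le_one_div_F hf)) (by positivity)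

end Params.Admissible

end Coefficients

/-! ### Continuity and coercivity of the elastic form -/

section Elastic

variable {d : ℕ} {Ω : Set (Vec d)}

/-- The elastic form of the displacement equation, with coefficients frozen at `uOld`. -/
def elastic (M : Params) (uOld u z : H10 Ω) : ℝ :=
  1 / M.E₁ * (∫ x in Ω,
      1 / (1 + M.lam₁ * trunc M.δ (dvg uOld x)) * inner ℝ (strain u x) (strain z x))
  + |M.E₂| / M.E₁ * (∫ x in Ω,
      (1 + M.lam₂ * trunc M.δ (dvg uOld x)) / (1 + M.lam₁ * trunc M.δ (dvg uOld x))
      * (1 / M.F d (trunc M.δ (dvg uOld x))) * (dvg u x * dvg z x))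

theorem elastic_eq (M : Params) (uOld u z : H10 Ω) :
    elastic M uOld u z = 1 / M.E₁ * (∫ x in Ω,
      1 / (1 + M.lam₁ * trunc M.δ (dvg uOld x))
        * inner ℝ (symLp Ω (grad u) x) (symLp Ω (grad z) x))
    + |M.E₂| / M.E₁ * (∫ x in Ω,
      (1 + M.lam₂ * trunc M.δ (dvg uOld x)) / (1 + M.lam₁ * trunc M.δ (dvg uOld x))
      * (1 / M.F d (trunc M.δ (dvg uOld x)))
      * inner ℝ (trLp Ω (grad u) x) (trLp Ω (grad z) x)) := by
  unfold elastic
  congr 2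
  · refine integral_congr_ae ?_
    filter_upwards [symLp_grad_ae u, symLp_grad_ae z] with x h1 h2
    rw [h1, h2]
  · refine integral_congr_ae ?_
    filter_upwards [trLp_grad_ae u, trLp_grad_ae z] with x h1 h2
    rw [h1, h2, Real.inner_apply]

/-- Strain and divergence of `u` are kept apart, because the coercivity bound `le_elastic_self`
controls exactly these two norms with different weights. -/
theorem abs_elastic_le {M : Params} (hM : M.Admissible d) (uOld u z : H10 Ω) :
    |elastic M uOld u z| ≤ M.γ₂ / M.E₁ * (‖symLp Ω (grad u)‖
      + |M.E₂| * (M.γ₆ d * M.γ₈) * ‖trLp Ω (grad u)‖) * ‖grad z‖ := by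
  have hE := hM.E₁_pos
  have ht := fun x => abs_trunc_le hM.δ_pos (dvg uOld x)
  have h1 := hM.γ₁_pos
  have h2 := hM.γ₂_pos
  have h5 := hM.γ₅_pos
  have h6 := hM.γ₆_pos
  have h7 := hM.γ₇_pos
  have h8 := hM.γ₈_pos
  rw [elastic_eq]
  refine (abs_add_le _ _).trans ?_
  rw [abs_mul, abs_mul, abs_of_nonneg (show 0 ≤ 1 / M.E₁ by positivity),
    abs_of_nonneg (show 0 ≤ |M.E₂| / M.E₁ by positivity)]
  have b1 := abs_integral_weight_inner_le (μ := volume.restrict Ω)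
    (a := fun x => 1 / (1 + M.lam₁ * trunc M.δ (dvg uOld x))) (A := M.γ₂)
    (fun x => by
      rw [abs_of_nonneg (h1.le.trans (hM.le_coeff₁ (ht x)))]
      exact hM.coeff₁_le (ht x)) (symLp Ω (grad u)) (symLp Ω (grad z))
  have b2 := abs_integral_weight_inner_le (μ := volume.restrict Ω)
    (a := fun x => (1 + M.lam₂ * trunc M.δ (dvg uOld x)) / (1 + M.lam₁ * trunc M.δ (dvg uOld x))
      * (1 / M.F d (trunc M.δ (dvg uOld x)))) (A := M.γ₈ * M.γ₂ * M.γ₆ d)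
    (fun x => by
      rw [abs_of_nonneg ((by positivity : 0 ≤ M.γ₇ * M.γ₁ * M.γ₅ d).trans (hM.le_coeff₂ (ht x)))]
      exact hM.coeff₂_le (ht x)) (trLp Ω (grad u)) (trLp Ω (grad z))
  calc _ ≤ 1 / M.E₁ * (M.γ₂ * (‖symLp Ω (grad u)‖ * ‖grad z‖))
        + |M.E₂| / M.E₁ * (M.γ₈ * M.γ₂ * M.γ₆ d * (‖trLp Ω (grad u)‖ * ‖grad z‖)) := by
        refine add_le_add (mul_le_mul_of_nonneg_left (b1.trans ?_) (by positivity))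
          (mul_le_mul_of_nonneg_left (b2.trans ?_) (by positivity))
        · have := norm_symLp_le (grad z)
          gcongr
        · have := norm_trLp_grad_le z
          gcongr
    _ = _ := by ring

theorem le_elastic_self {M : Params} (hM : M.Admissible d) (uOld u : H10 Ω) :
    M.γ₁ / M.E₁ * ‖symLp Ω (grad u)‖ ^ 2
      + |M.E₂| / M.E₁ * (M.γ₇ * M.γ₁ * M.γ₅ d) * ‖trLp Ω (grad u)‖ ^ 2
      ≤ elastic M uOld u u := by
  have hE := hM.E₁_pos
  have ht := fun x => abs_trunc_le hM.δ_pos (dvg uOld x)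
  have h1 := hM.γ₁_pos
  have h5 := hM.γ₅_pos
  have h7 := hM.γ₇_pos
  -- Measurability of the divergence is inherited from its `L²` representative, with which it agrees
  -- almost everywhere.
  have hm : AEMeasurable (fun x => trunc M.δ (dvg uOld x)) (volume.restrict Ω) :=
    (measurable_trunc hM.δ_pos).comp_aemeasurable
      ((Lp.aestronglyMeasurable (trLp Ω (grad uOld))).aemeasurable.congr (trLp_grad_ae uOld))
  rw [elastic_eq]
  have b1 := le_integral_weight_inner_self (μ := volume.restrict Ω)
    (a := fun x => 1 / (1 + M.lam₁ * trunc M.δ (dvg uOld x))) (A := M.γ₁) (B := M.γ₂)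
    (fun x => hM.le_coeff₁ (ht x))
    (fun x => by
      rw [abs_of_nonneg (h1.le.trans (hM.le_coeff₁ (ht x)))]
      exact hM.coeff₁_le (ht x))
    (by
      refine AEMeasurable.aestronglyMeasurable ?_
      exact ((hm.const_mul M.lam₁).const_add 1).const_div 1) (symLp Ω (grad u))
  have b2 := le_integral_weight_inner_self (μ := volume.restrict Ω)
    (a := fun x => (1 + M.lam₂ * trunc M.δ (dvg uOld x)) / (1 + M.lam₁ * trunc M.δ (dvg uOld x))
      * (1 / M.F d (trunc M.δ (dvg uOld x)))) (A := M.γ₇ * M.γ₁ * M.γ₅ d)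
    (B := M.γ₈ * M.γ₂ * M.γ₆ d)
    (fun x => hM.le_coeff₂ (ht x))
    (fun x => by
      rw [abs_of_nonneg ((by positivity : 0 ≤ M.γ₇ * M.γ₁ * M.γ₅ d).trans (hM.le_coeff₂ (ht x)))]
      exact hM.coeff₂_le (ht x))
    (by
      refine AEMeasurable.aestronglyMeasurable ?_
      simp_rw [hM.F_eq]
      exact (((hm.const_mul M.lam₂).const_add 1).div ((hm.const_mul M.lam₁).const_add 1)).mul
        (((hm.const_mul (M.γ₄ d)).const_add _).const_div 1)) (trLp Ω (grad u))
  calc _ = 1 / M.E₁ * (M.γ₁ * ‖symLp Ω (grad u)‖ ^ 2)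
        + |M.E₂| / M.E₁ * (M.γ₇ * M.γ₁ * M.γ₅ d * ‖trLp Ω (grad u)‖ ^ 2) := by ring
    _ ≤ _ := by gcongr

end Elastic

/-! ### Discrete Gronwall inequality and absorption algebra -/

section Discrete

/-- A discrete Gronwall inequality for an implicit step of size `x ≤ 1 / 2`. -/
theorem discrete_gronwall {Y Z W : ℕ → ℝ} {x : ℝ} {N : ℕ} (hx : 0 ≤ x) (hx2 : 2 * x ≤ 1)
    (hY0 : 0 ≤ Y 0) (hZ : ∀ n ∈ Finset.Icc 1 N, 0 ≤ Z n) (hW : ∀ n ∈ Finset.Icc 1 N, W n ≤ Y n)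
    (h : ∀ n ∈ Finset.Icc 1 N, Y n - Y (n - 1) + Z n ≤ x * W n) :
    ∀ n ≤ N, Y n + ∑ i ∈ Finset.Icc 1 n, Z i ≤ Y 0 * Real.exp (2 * x * n) := by
  intro n
  induction n with
  | zero => intro _; simp
  | succ n ih =>
    intro hn
    have hmem : n + 1 ∈ Finset.Icc 1 N := Finset.mem_Icc.2 ⟨by omega, hn⟩
    have h1 := h _ hmem
    have h2 := mul_le_mul_of_nonneg_left (hW _ hmem) hx
    have h3 := ih (by omega)
    simp only [Nat.add_sub_cancel] at h1
    rw [Finset.sum_Icc_succ_top (by omega)]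
    have hS : 0 ≤ ∑ i ∈ Finset.Icc 1 n, Z i := Finset.sum_nonneg fun i hi =>
      hZ i (Finset.mem_Icc.2 ⟨(Finset.mem_Icc.1 hi).1, (Finset.mem_Icc.1 hi).2.trans (by omega)⟩)
    have hZn := hZ _ hmem
    set S := ∑ i ∈ Finset.Icc 1 n, Z i
    set Q := Y 0 * Real.exp (2 * x * n) with hQ
    have hQ0 : 0 ≤ Q := by positivity
    -- The implicit term `x W ≤ x Y` moves to the left; the extra `-x (S + Z)` is harmless since
    -- both are nonnegative.
    have hb : (Y (n + 1) + (S + Z (n + 1))) * (1 - x) ≤ Q := by nlinarith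
    -- `1 / (1 - x) ≤ 1 + 2x` amounts to `x (1 - 2x) ≥ 0`, which is where `2x ≤ 1` enters.
    have hstep : Y (n + 1) + (S + Z (n + 1)) ≤ Q * (1 + 2 * x) := by
      rw [← le_div_iff₀ (by linarith)] at hb
      refine hb.trans ((div_le_iff₀ (by linarith)).2 ?_)
      have : 0 ≤ Q * (x * (1 - 2 * x)) := by
        have : 0 ≤ 1 - 2 * x := by linarith
        positivity
      nlinarith
    refine hstep.trans ?_
    have hexp : 1 + 2 * x ≤ Real.exp (2 * x) := by linarith [Real.add_one_le_exp (2 * x)]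
    calc Q * (1 + 2 * x) ≤ Q * Real.exp (2 * x) := mul_le_mul_of_nonneg_left hexp hQ0
      _ = _ := by rw [hQ, mul_assoc, ← Real.exp_add]; push_cast; ring_nf

theorem inner_sub_self_eq {E : Type*} [NormedAddCommGroup E] [InnerProductSpace ℝ E] (a b : E) :
    inner ℝ (a - b) a = (‖a‖ ^ 2 - ‖b‖ ^ 2 + ‖a - b‖ ^ 2) / 2 := by
  rw [norm_sub_sq_real, inner_sub_left, real_inner_self_eq_norm_sq, real_inner_comm]
  ring

/-- Young's inequality, spending half of the strain term `g/E e²` on the load and retaining the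
other half; the result is then scaled by `2τ/α`. -/
theorem displacement_absorb {α τ E g D e W L V : ℝ} (hα : 0 < α) (hτ : 0 < τ) (hE : 0 < E)
    (hg : 0 < g) (h : α / τ * (D / 2) + (g / E * e ^ 2 + W) ≤ α * (V * (L * e))) :
    D + τ * (2 / α) * (g / (2 * E) * e ^ 2 + W) ≤ τ * (α * L ^ 2 * E / g) * V ^ 2 := by
  have h0 : 0 ≤ g / (2 * E) * (e - α * L * E / g * V) ^ 2 := by positivity
  have h1 : g / (2 * E) * (e - α * L * E / g * V) ^ 2
      = g / E * e ^ 2 - g / (2 * E) * e ^ 2 + α ^ 2 * L ^ 2 * E / (2 * g) * V ^ 2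
        - α * (V * (L * e)) := by
    field_simp
    ring
  have h2 : α / τ * (D / 2) + (g / (2 * E) * e ^ 2 + W)
      ≤ α ^ 2 * L ^ 2 * E / (2 * g) * V ^ 2 := by linarith
  have h3 := mul_le_mul_of_nonneg_left h2 (show 0 ≤ 2 * τ / α by positivity)
  have l1 : 2 * τ / α * (α / τ * (D / 2) + (g / (2 * E) * e ^ 2 + W))
      = D + τ * (2 / α) * (g / (2 * E) * e ^ 2 + W) := by
    field_simp
  have l2 : 2 * τ / α * (α ^ 2 * L ^ 2 * E / (2 * g) * V ^ 2)
      = τ * (α * L ^ 2 * E / g) * V ^ 2 := by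
    field_simp
  rwa [l1, l2] at h3

/-- Young's inequality against half of the viscous term, scaled by `2τ/r`. The factor `3` comes from
`(a + b + c)² ≤ 3 (a² + b² + c²)`. -/
theorem fluid_absorb {r τ n D G H C a b c : ℝ} (hr : 0 < r) (hτ : 0 < τ) (hn : 0 < n)
    (h : r / τ * (D / 2) + n * G ^ 2 + H ≤ C * (a + b + c) * G) :
    D + n / r * (τ * G ^ 2) + 2 * τ / r * H
      ≤ 3 * C ^ 2 / (n * r) * (τ * (a ^ 2 + b ^ 2 + c ^ 2)) := by
  have h0 : 0 ≤ n / 2 * (G - C * (a + b + c) / n) ^ 2 := by positivity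
  have h1 : n / 2 * (G - C * (a + b + c) / n) ^ 2 = n / 2 * G ^ 2
      + C ^ 2 / (2 * n) * (a + b + c) ^ 2 - C * (a + b + c) * G := by
    field_simp
    ring
  have h2 : (a + b + c) ^ 2 ≤ 3 * (a ^ 2 + b ^ 2 + c ^ 2) := by
    nlinarith [sq_nonneg (a - b), sq_nonneg (b - c), sq_nonneg (a - c)]
  have h3 := mul_le_mul_of_nonneg_left h2 (show 0 ≤ C ^ 2 / (2 * n) by positivity)
  have h4 : r / τ * (D / 2) + n / 2 * G ^ 2 + H
      ≤ C ^ 2 / (2 * n) * (3 * (a ^ 2 + b ^ 2 + c ^ 2)) := by linarith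
  have h5 := mul_le_mul_of_nonneg_left h4 (show 0 ≤ 2 * τ / r by positivity)
  have l1 : 2 * τ / r * (r / τ * (D / 2) + n / 2 * G ^ 2 + H)
      = D + n / r * (τ * G ^ 2) + 2 * τ / r * H := by
    field_simp
  have l2 : 2 * τ / r * (C ^ 2 / (2 * n) * (3 * (a ^ 2 + b ^ 2 + c ^ 2)))
      = 3 * C ^ 2 / (n * r) * (τ * (a ^ 2 + b ^ 2 + c ^ 2)) := by
    field_simp
  rwa [l1, l2] at h5

/-- This explains the form of `D₃`: in `(s²/τ + R)(DU² + τB)` the product `s²/τ · DU²` pays for the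
interpolation error, `R · τB` pays for the stress, and the two mixed products are nonnegative and
dropped. In the application `s = α h`. -/
theorem step_combine {τ s R B k q c V Un Uo DU A D3 Z : ℝ} (hτ : 0 < τ)
    (hR : 0 ≤ R) (hB : 0 ≤ B) (hk : 0 ≤ k) (hD3 : D3 = s ^ 2 / τ + R) (hA : A ^ 2 ≤ R * B)
    (hu : D3 * (Un - Uo + (DU ^ 2 + τ * B)) ≤ D3 * (τ * c * V ^ 2))
    (hv : Z ≤ k * (τ * ((s / τ * DU) ^ 2 + (q * V) ^ 2 + A ^ 2))) :
    Z + k * D3 * (Un - Uo) ≤ k * (q ^ 2 + D3 * c) * τ * V ^ 2 := by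
  have q1 : τ * (s / τ * DU) ^ 2 = s ^ 2 / τ * DU ^ 2 := by field_simp
  have q2 := mul_le_mul_of_nonneg_left hA hτ.le
  have q3 : 0 ≤ R * DU ^ 2 := by positivity
  have q4 : 0 ≤ s ^ 2 / τ * (τ * B) := by positivity
  have q5 : τ * ((s / τ * DU) ^ 2 + A ^ 2) ≤ D3 * (DU ^ 2 + τ * B) := by
    rw [hD3, mul_add, q1]
    linarith
  have q6 : τ * ((s / τ * DU) ^ 2 + (q * V) ^ 2 + A ^ 2) + D3 * (Un - Uo)
      ≤ (q ^ 2 + D3 * c) * τ * V ^ 2 := by linarith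
  have q7 := mul_le_mul_of_nonneg_left q6 hk
  linarith

/-! ### Energy estimates for one time step -/

variable {d : ℕ} {Ω : Set (Vec d)}

theorem displacementStep_iff (M : Params) (U : Submodule ℝ (H10 Ω)) (τ : ℝ) (uOld u v : H10 Ω) :
    DisplacementStep M U τ uOld u v ↔ ∀ z ∈ U,
      M.α / τ * inner ℝ (fld u - fld uOld) (fld z) + elastic M uOld u z
        = M.α * inner ℝ (fld v) (fld z) := by
  simp only [DisplacementStep, elastic, integral_inner_sub_eq, L2.inner_def (fld v), add_assoc]

theorem FluidStep.self {M : Params} {X : Submodule ℝ (H10 Ω)} {τ : ℝ} {uOld u vOld v : H10 Ω}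
    {p : L2S Ω} (h : FluidStep M X τ uOld u vOld v p) (hv : v ∈ X)
    (hp : ∫ x in Ω, p x * dvg v x = 0) :
    M.rho / τ * inner ℝ (fld v - fld vOld) (fld v) + M.ν * ‖grad v‖ ^ 2 + M.α * ‖fld v‖ ^ 2
      = M.α / τ * inner ℝ (fld u - fld uOld) (fld v) := by
  have h := h v hv
  rw [hp, integral_inner_sub_eq, integral_inner_sub_eq, sub_zero] at h
  rw [← real_inner_self_eq_norm_sq, ← real_inner_self_eq_norm_sq, L2.inner_def (grad v),
    L2.inner_def (fld v) (fld v)]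
  exact h

/-- The energy estimate for the displacement equation. -/
theorem displacement_energy {M : Params} (hM : M.Admissible d) {P K : ℝ}
    (hP : IsPoincareConst Ω P) (hK : IsKornConst Ω K) {U : Submodule ℝ (H10 Ω)} {τ : ℝ}
    (hτ : 0 < τ) {uOld u v : H10 Ω} (hu : u ∈ U) (h : DisplacementStep M U τ uOld u v) :
    ‖fld u‖ ^ 2 - ‖fld uOld‖ ^ 2 + (‖fld u - fld uOld‖ ^ 2
      + τ * (M.γ₁ / (M.α * M.E₁)) * (‖symLp Ω (grad u)‖ ^ 2
        + 2 * |M.E₂| * (M.γ₇ * M.γ₅ d) * ‖trLp Ω (grad u)‖ ^ 2))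
      ≤ τ * (M.α * (P * K) ^ 2 * M.E₁ / M.γ₁) * ‖fld v‖ ^ 2 := by
  have hα := hM.α_pos
  have hE := hM.E₁_pos
  have h1 := hM.γ₁_pos
  have heq := (displacementStep_iff _ _ _ _ _ _).1 h u hu
  rw [inner_sub_self_eq] at heq
  have hel := le_elastic_self hM uOld u
  have hgr := hK.2 u
  rw [sqrt_integral_norm_strain_sq] at hgr
  -- Poincaré and then Korn turn the load into a multiple of the strain norm, which the elastic
  -- dissipation can absorb.
  have hin : inner ℝ (fld v) (fld u) ≤ ‖fld v‖ * (P * (K * ‖symLp Ω (grad u)‖)) :=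
    (real_inner_le_norm _ _).trans (mul_le_mul_of_nonneg_left
      ((hP.2 u).trans (mul_le_mul_of_nonneg_left hgr hP.1.le)) (norm_nonneg _))
  have hin2 := mul_le_mul_of_nonneg_left hin hα.le
  rw [← mul_assoc P K] at hin2
  have h := displacement_absorb hα hτ hE h1 ((add_le_add_right hel _).trans (heq.trans_le hin2))
  have l : τ * (M.γ₁ / (M.α * M.E₁)) * (‖symLp Ω (grad u)‖ ^ 2
      + 2 * |M.E₂| * (M.γ₇ * M.γ₅ d) * ‖trLp Ω (grad u)‖ ^ 2)
      = τ * (2 / M.α) * (M.γ₁ / (2 * M.E₁) * ‖symLp Ω (grad u)‖ ^ 2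
        + |M.E₂| / M.E₁ * (M.γ₇ * M.γ₁ * M.γ₅ d) * ‖trLp Ω (grad u)‖ ^ 2) := by
    field_simp
  rwa [l, ← add_assoc]

/-- The energy estimate for the fluid equation, with the displacement increment and the elastic
stress on the right-hand side. -/
theorem fluid_energy {M : Params} (hM : M.Admissible d) {P C : ℝ} (hP : IsPoincareConst Ω P)
    (S : Discretization Ω C) {τ : ℝ} (hτ : 0 < τ) {uOld u vOld v : H10 Ω} {p : L2S Ω}
    (hv : v ∈ S.Vh) (hp : p ∈ S.Q) (hu : DisplacementStep M S.U τ uOld u v)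
    (hf : FluidStep M S.X τ uOld u vOld v p) :
    ‖fld v‖ ^ 2 - ‖fld vOld‖ ^ 2 + (‖fld v - fld vOld‖ ^ 2 + M.ν / M.rho * (τ * ‖grad v‖ ^ 2)
      + 2 * (M.α / M.rho) * (τ * ‖fld v‖ ^ 2))
      ≤ 3 * C ^ 2 / (M.ν * M.rho) * (τ * ((M.α * S.h / τ * ‖fld u - fld uOld‖) ^ 2
        + (M.α * P * ‖fld v‖) ^ 2
        + (M.γ₂ / M.E₁ * (‖symLp Ω (grad u)‖
          + |M.E₂| * (M.γ₆ d * M.γ₈) * ‖trLp Ω (grad u)‖)) ^ 2)) := by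
  have hα := hM.α_pos
  have hν := hM.ν_pos
  have hρ := hM.rho_pos
  have hE := hM.E₁_pos
  have h2 := hM.γ₂_pos
  have h6 := hM.γ₆_pos
  have h8 := hM.γ₈_pos
  have heq := hf.self hv.1 (hv.2 p hp)
  rw [inner_sub_self_eq] at heq
  -- The interpolant of the velocity is the test function that couples the two equations; `hsub`
  -- accounts for the remainder `v - Πv`.
  have hdis := (displacementStep_iff _ _ _ _ _ _).1 hu _ (S.intU_mem v)
  have hst := S.intU_stable v
  have hap := S.intU_approx v
  have hel : -elastic M uOld u (S.intU v) ≤ M.γ₂ / M.E₁ * (‖symLp Ω (grad u)‖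
      + |M.E₂| * (M.γ₆ d * M.γ₈) * ‖trLp Ω (grad u)‖) * (C * ‖grad v‖) :=
    (neg_le_abs _).trans ((abs_elastic_le hM uOld u _).trans (by gcongr))
  have hin : inner ℝ (fld v) (fld (S.intU v)) ≤ ‖fld v‖ * (P * (C * ‖grad v‖)) :=
    (real_inner_le_norm _ _).trans (mul_le_mul_of_nonneg_left
      ((hP.2 _).trans (mul_le_mul_of_nonneg_left hst hP.1.le)) (norm_nonneg _))
  have hsub : inner ℝ (fld u - fld uOld) (fld v - fld (S.intU v))
      ≤ ‖fld u - fld uOld‖ * (C * S.h * ‖grad v‖) :=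
    (real_inner_le_norm _ _).trans (mul_le_mul_of_nonneg_left hap (norm_nonneg _))
  rw [inner_sub_right] at hsub
  have m1 := mul_le_mul_of_nonneg_left hsub (show 0 ≤ M.α / τ by positivity)
  have m2 := mul_le_mul_of_nonneg_left hin hα.le
  have hmain : M.rho / τ * ((‖fld v‖ ^ 2 - ‖fld vOld‖ ^ 2 + ‖fld v - fld vOld‖ ^ 2) / 2)
      + M.ν * ‖grad v‖ ^ 2 + M.α * ‖fld v‖ ^ 2
      ≤ C * (M.α * S.h / τ * ‖fld u - fld uOld‖ + M.α * P * ‖fld v‖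
        + M.γ₂ / M.E₁ * (‖symLp Ω (grad u)‖
          + |M.E₂| * (M.γ₆ d * M.γ₈) * ‖trLp Ω (grad u)‖)) * ‖grad v‖ := by
    generalize M.γ₂ / M.E₁ * (‖symLp Ω (grad u)‖
      + |M.E₂| * (M.γ₆ d * M.γ₈) * ‖trLp Ω (grad u)‖) = A at hel ⊢
    have e1 : C * (M.α * S.h / τ * ‖fld u - fld uOld‖ + M.α * P * ‖fld v‖ + A) * ‖grad v‖
        = M.α / τ * (‖fld u - fld uOld‖ * (C * S.h * ‖grad v‖))
          + M.α * (‖fld v‖ * (P * (C * ‖grad v‖))) + A * (C * ‖grad v‖) := by ring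
    rw [e1]
    linarith
  refine le_of_eq_of_le ?_ (fluid_absorb hρ hτ hν hmain)
  ring

/-- The elastic stress is controlled by the dissipation of the displacement equation. -/
theorem stress_sq_le {M : Params} (hM : M.Admissible d) (e w : ℝ) :
    (M.γ₂ / M.E₁ * (e + |M.E₂| * (M.γ₆ d * M.γ₈) * w)) ^ 2
      ≤ M.α / M.E₁ * (M.γ₂ ^ 2 / M.γ₁) * M.D₂ d
        * (M.γ₁ / (M.α * M.E₁) * (e ^ 2 + 2 * |M.E₂| * (M.γ₇ * M.γ₅ d) * w ^ 2)) := by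
  have hα := hM.α_pos
  have hE := hM.E₁_pos
  have h1 := hM.γ₁_pos
  have h5 := hM.γ₅_pos
  have h7 := hM.γ₇_pos
  have hE2 : 0 < |M.E₂| := abs_pos.2 hM.E₂_neg.ne
  have key : (e + |M.E₂| * (M.γ₆ d * M.γ₈) * w) ^ 2
      ≤ M.D₂ d * (e ^ 2 + 2 * |M.E₂| * (M.γ₇ * M.γ₅ d) * w ^ 2) := by
    -- This is a weighted Cauchy–Schwarz inequality whose sharp constant is `D₂ = 1 + D₁/2`; its
    -- defect is this perfect square.
    have h0 : 0 ≤ |M.E₂| / (2 * (M.γ₅ d * M.γ₇))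
        * (M.γ₆ d * M.γ₈ * e - 2 * (M.γ₅ d * M.γ₇) * w) ^ 2 := by positivity
    have e0 : M.D₂ d * (e ^ 2 + 2 * |M.E₂| * (M.γ₇ * M.γ₅ d) * w ^ 2)
        - (e + |M.E₂| * (M.γ₆ d * M.γ₈) * w) ^ 2
        = |M.E₂| / (2 * (M.γ₅ d * M.γ₇))
          * (M.γ₆ d * M.γ₈ * e - 2 * (M.γ₅ d * M.γ₇) * w) ^ 2 := by
      unfold Params.D₂ Params.D₁
      field_simp
      ring
    linarith
  have hm := mul_le_mul_of_nonneg_left key (sq_nonneg (M.γ₂ / M.E₁))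
  rw [mul_pow]
  refine hm.trans (le_of_eq ?_)
  field_simp

/-- The combined energy estimate for one time step. -/
theorem step_energy {M : Params} (hM : M.Admissible d) {P K C : ℝ} (hP : IsPoincareConst Ω P)
    (hK : IsKornConst Ω K) (S : Discretization Ω C) {τ : ℝ} (hτ : 0 < τ)
    {uOld u vOld v : H10 Ω} {p : L2S Ω} (hu : u ∈ S.U) (hv : v ∈ S.Vh) (hp : p ∈ S.Q)
    (hd : DisplacementStep M S.U τ uOld u v) (hf : FluidStep M S.X τ uOld u vOld v p) :
    (‖fld v‖ ^ 2 + 3 * C ^ 2 * M.D₃ d S.h τ / (M.ν * M.rho) * ‖fld u‖ ^ 2)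
      - (‖fld vOld‖ ^ 2 + 3 * C ^ 2 * M.D₃ d S.h τ / (M.ν * M.rho) * ‖fld uOld‖ ^ 2)
      + (‖fld v - fld vOld‖ ^ 2 + M.ν / M.rho * (τ * ‖grad v‖ ^ 2)
        + 2 * (M.α / M.rho) * (τ * ‖fld v‖ ^ 2))
      ≤ 3 * (C ^ 2 * M.D₄ d P K S.h τ / (M.ν * M.rho)) * τ * ‖fld v‖ ^ 2 := by
  have hα := hM.α_pos
  have hν := hM.ν_pos
  have hρ := hM.rho_pos
  have hE := hM.E₁_pos
  have h1 := hM.γ₁_pos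
  have h5 := hM.γ₅_pos
  have h7 := hM.γ₇_pos
  have hD2 := hM.D₂_pos
  have hD3 := hM.D₃_pos S.h hτ
  have hue := displacement_energy hM hP hK hτ hu hd
  rw [mul_assoc τ (M.γ₁ / (M.α * M.E₁))] at hue
  have h := step_combine hτ
    (show 0 ≤ M.α / M.E₁ * (M.γ₂ ^ 2 / M.γ₁) * M.D₂ d by positivity)
    (show 0 ≤ M.γ₁ / (M.α * M.E₁) * (‖symLp Ω (grad u)‖ ^ 2
      + 2 * |M.E₂| * (M.γ₇ * M.γ₅ d) * ‖trLp Ω (grad u)‖ ^ 2) by positivity)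
    (show 0 ≤ 3 * C ^ 2 / (M.ν * M.rho) by positivity) rfl (stress_sq_le hM _ _)
    (mul_le_mul_of_nonneg_left hue hD3.le) (fluid_energy hM hP S hτ hv hp hd hf)
  -- `D₄` collects the two coefficients of `‖v‖²`: the one from the fluid estimate, and `D₃` times
  -- the one from the displacement estimate.
  have hc : M.D₄ d P K S.h τ = (M.α * P) ^ 2
      + M.D₃ d S.h τ * (M.α * (P * K) ^ 2 * M.E₁ / M.γ₁) := by
    unfold Params.D₄
    field_simp
  change _ + 3 * C ^ 2 / (M.ν * M.rho) * M.D₃ d S.h τ * _ ≤ 3 * C ^ 2 / (M.ν * M.rho)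
    * ((M.α * P) ^ 2 + M.D₃ d S.h τ * (M.α * (P * K) ^ 2 * M.E₁ / M.γ₁)) * _ * _ at h
  rw [← hc] at h
  refine le_of_eq_of_le ?_ (h.trans_eq ?_) <;> ring

/-! ### Summation in time -/

theorem velocityEnergy_le {M : Params} (hM : M.Admissible d) {P K C : ℝ}
    (hP : IsPoincareConst Ω P) (hK : IsKornConst Ω K) {S : Discretization Ω C} {τ : ℝ}
    (hτ : 0 < τ) {N : ℕ} {u₀ v₀ : H10 Ω} {u v : ℕ → H10 Ω} {p : ℕ → L2S Ω}
    (h : IsDiscreteSolution M S τ N u₀ v₀ u v p)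
    (hstep : 6 * (C ^ 2 * M.D₄ d P K S.h τ / (M.ν * M.rho)) * τ ≤ 1) {n : ℕ}
    (hn : n ∈ Finset.Icc 1 N) :
    velocityEnergy M τ v n ≤ M.C₁ d C S.h τ ‖fld (u 0)‖ ‖fld (v 0)‖ *
      Real.exp (M.C₂ d P K C S.h τ * (n * τ)) := by
  have hα := hM.α_pos
  have hν := hM.ν_pos
  have hρ := hM.rho_pos
  have hD3 := hM.D₃_pos S.h hτ
  have hD4 := hM.D₄_nonneg P K S.h hτ
  obtain ⟨hn1, hnN⟩ := Finset.mem_Icc.1 hn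
  have hY0 : 0 ≤ ‖fld (v 0)‖ ^ 2
      + 3 * C ^ 2 * M.D₃ d S.h τ / (M.ν * M.rho) * ‖fld (u 0)‖ ^ 2 := by positivity
  have hg := discrete_gronwall (N := N)
    (Y := fun n => ‖fld (v n)‖ ^ 2
      + 3 * C ^ 2 * M.D₃ d S.h τ / (M.ν * M.rho) * ‖fld (u n)‖ ^ 2)
    (Z := fun n => ‖fld (v n) - fld (v (n - 1))‖ ^ 2 + M.ν / M.rho * (τ * ‖grad (v n)‖ ^ 2)
        + 2 * (M.α / M.rho) * (τ * ‖fld (v n)‖ ^ 2))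
    (W := fun n => ‖fld (v n)‖ ^ 2)
    (x := 3 * (C ^ 2 * M.D₄ d P K S.h τ / (M.ν * M.rho)) * τ) (by positivity) (by linarith) hY0
    (fun n _ => by positivity) (fun n _ => le_add_of_nonneg_right (by positivity))
    (fun n hn => step_energy hM hP hK S hτ (h.mem_u n hn) (h.mem_v n hn) (h.mem_p n hn)
      (h.displacement n hn) (h.fluid n hn)) n hnN
  simp only [Finset.sum_add_distrib, ← Finset.mul_sum] at hg
  -- Gronwall controls the increments up to `n`; the stated energy contains them only up to `n - 1`.
  have hinc : ∑ i ∈ Finset.Icc 1 (n - 1), ‖fld (v i) - fld (v (i - 1))‖ ^ 2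
      ≤ ∑ i ∈ Finset.Icc 1 n, ‖fld (v i) - fld (v (i - 1))‖ ^ 2 :=
    Finset.sum_le_sum_of_subset_of_nonneg (Finset.Icc_subset_Icc_right (Nat.sub_le _ _))
      fun i _ _ => sq_nonneg _
  have hu : 0 ≤ 3 * C ^ 2 * M.D₃ d S.h τ / (M.ν * M.rho) * ‖fld (u n)‖ ^ 2 := by positivity
  -- The argument yields the rate constant `6`, which is weakened to the `9` in `C₂`.
  have hexp : Real.exp (2 * (3 * (C ^ 2 * M.D₄ d P K S.h τ / (M.ν * M.rho)) * τ) * n)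
      ≤ Real.exp (M.C₂ d P K C S.h τ * (n * τ)) := by
    refine Real.exp_le_exp.2 ?_
    have h0 : 0 ≤ C ^ 2 * M.D₄ d P K S.h τ / (M.ν * M.rho) * (n * τ) := by positivity
    have e : M.C₂ d P K C S.h τ * (n * τ)
        = 9 * (C ^ 2 * M.D₄ d P K S.h τ / (M.ν * M.rho) * (n * τ)) := by
      unfold Params.C₂
      ring
    rw [e]
    linarith
  have hfin := mul_le_mul_of_nonneg_left hexp hY0
  unfold velocityEnergy Params.C₁
  rw [← Finset.mul_sum, ← Finset.mul_sum]
  linarith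

/-! ### Bounds uniform in the mesh size and the time step -/

/-- The discretization enters only through `h²/τ ≤ 1`, so the value at `h = τ = 1` is a uniform
bound; the other constants inherit this by monotonicity. -/
theorem D₃_le (M : Params) (d : ℕ) {h τ : ℝ} (hτ : 0 < τ) (hh : h ^ 2 ≤ τ) :
    M.D₃ d h τ ≤ M.D₃ d 1 1 := by
  have : (M.α * h) ^ 2 / τ ≤ M.α ^ 2 := by
    rw [div_le_iff₀ hτ, mul_pow]
    gcongr
  simp only [Params.D₃, mul_one, div_one]
  linarith

theorem D₄_le {M : Params} (hM : M.Admissible d) (P K : ℝ) {h τ : ℝ} (hτ : 0 < τ)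
    (hh : h ^ 2 ≤ τ) : M.D₄ d P K h τ ≤ M.D₄ d P K 1 1 := by
  have := hM.α_pos
  have := hM.E₁_pos
  have := hM.γ₁_pos
  have := D₃_le M d hτ hh
  unfold Params.D₄
  gcongr

theorem C₂_le {M : Params} (hM : M.Admissible d) (P K C : ℝ) {h τ : ℝ} (hτ : 0 < τ)
    (hh : h ^ 2 ≤ τ) : M.C₂ d P K C h τ ≤ M.C₂ d P K C 1 1 := by
  have := hM.ν_pos
  have := hM.rho_pos
  have := D₄_le hM P K hτ hh
  unfold Params.C₂
  gcongr

theorem C₁_nonneg {M : Params} (hM : M.Admissible d) (C h a b : ℝ) {τ : ℝ} (hτ : 0 < τ) :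
    0 ≤ M.C₁ d C h τ a b := by
  have := hM.ν_pos
  have := hM.rho_pos
  have := hM.D₃_pos h hτ
  unfold Params.C₁
  positivity

theorem C₁_le {M : Params} (hM : M.Admissible d) (C : ℝ) {h τ a b a' b' : ℝ} (hτ : 0 < τ)
    (hh : h ^ 2 ≤ τ) (ha : 0 ≤ a) (hb : 0 ≤ b) (haa : a ≤ a') (hbb : b ≤ b') :
    M.C₁ d C h τ a b ≤ M.C₁ d C 1 1 a' b' := by
  have := hM.ν_pos
  have := hM.rho_pos
  have := hM.D₃_pos h hτ
  have := D₃_le M d hτ hh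
  have := hM.D₃_pos 1 one_pos
  unfold Params.C₁
  gcongr

end Discrete

end PorousFlow

end

open PorousFlow
theorem theorem3p3 (d : ℕ) (hd : d = 2 ∨ d = 3)
    (Ω : Set (Vec d)) (hΩ : IsOpen Ω) (hΩb : Bornology.IsBounded Ω)
    (M : Params) (hα : 0 < M.α) (hν : 0 < M.ν) (hrho : 0 < M.rho)
    (hE₁ : 0 < M.E₁) (hE₂ : M.E₂ < 0) (hE : 0 < M.E₁ - d * |M.E₂|)
    (hδ : 0 < M.δ)
    (hsmall₁ : 0 < 1 - |M.lam₁| * M.δ)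
    (hsmall₂ : 0 < M.γ₃ d - |M.γ₄ d| * M.δ)
    (hsmall₃ : 0 < 1 - |M.lam₂| * M.δ) :
    (∃ P, IsPoincareConst Ω P) ∧ (∃ K, IsKornConst Ω K) ∧
    ∀ P K C : ℝ, IsPoincareConst Ω P → IsKornConst Ω K → 0 < C →
      (∀ u₀ v₀ : H10 Ω, v₀ ∈ divFree Ω →
        ∀ (S : Discretization Ω C) (T : ℝ) (N : ℕ) (τ : ℝ), 0 < T → 1 < N → τ = T / N →
        ∀ (u v : ℕ → H10 Ω) (p : ℕ → L2S Ω), IsDiscreteSolution M S τ N u₀ v₀ u v p →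
        6 * (C ^ 2 * M.D₄ d P K S.h τ / (M.ν * M.rho)) * τ ≤ 1 →
        ∀ n ∈ Finset.Icc 1 N,
          velocityEnergy M τ v n ≤
            M.C₁ d C S.h τ ‖fld (u 0)‖ ‖fld (v 0)‖ *
              Real.exp (M.C₂ d P K C S.h τ * (n * τ))) ∧
      (∃ D₃' D₄' C₂' : ℝ, ∀ u₀ v₀ : H10 Ω, v₀ ∈ divFree Ω → ∃ C₁' : ℝ,
        ∀ (S : Discretization Ω C) (T : ℝ) (N : ℕ) (τ : ℝ), 0 < T → 1 < N → τ = T / N →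
        S.h ^ 2 ≤ τ →
        ∀ (u v : ℕ → H10 Ω) (p : ℕ → L2S Ω), IsDiscreteSolution M S τ N u₀ v₀ u v p →
          M.D₃ d S.h τ ≤ D₃' ∧ M.D₄ d P K S.h τ ≤ D₄' ∧
          M.C₁ d C S.h τ ‖fld (u 0)‖ ‖fld (v 0)‖ ≤ C₁' ∧ M.C₂ d P K C S.h τ ≤ C₂' ∧
          (6 * (C ^ 2 * M.D₄ d P K S.h τ / (M.ν * M.rho)) * τ ≤ 1 →
            ∀ n ∈ Finset.Icc 1 N,
              velocityEnergy M τ v n ≤ C₁' * Real.exp (C₂' * (n * τ)))) := by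
  have hM : M.Admissible d := ⟨hα, hν, hrho, hE₁, hE₂, hδ, hsmall₁, hsmall₂, hsmall₃⟩
  refine ⟨exists_isPoincareConst (by omega) hΩb, exists_isKornConst, fun P K C hP hK hC => ⟨?_, ?_⟩⟩
  · intro u₀ v₀ _ S T N τ hT hN hτ u v p h hstep n hn
    have hτ0 : 0 < τ := hτ ▸ div_pos hT (by exact_mod_cast (by omega : 0 < N))
    exact velocityEnergy_le hM hP hK hτ0 h hstep hn
  -- For `C₁'` the norms of the interpolated data are replaced by `P C ‖∇u₀‖` and `P C ‖∇v₀‖`, using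
  -- Poincaré and the gradient stability of the interpolation.
  · refine ⟨M.D₃ d 1 1, M.D₄ d P K 1 1, M.C₂ d P K C 1 1, fun u₀ v₀ hv₀ =>
      ⟨M.C₁ d C 1 1 (P * (C * ‖grad u₀‖)) (P * (C * ‖grad v₀‖)), ?_⟩⟩
    intro S T N τ hT hN hτ hh u v p h
    have hτ0 : 0 < τ := hτ ▸ div_pos hT (by exact_mod_cast (by omega : 0 < N))
    have hu : ‖fld (u 0)‖ ≤ P * (C * ‖grad u₀‖) := by
      rw [h.init_u]
      exact (hP.2 _).trans (mul_le_mul_of_nonneg_left (S.intU_stable u₀) hP.1.le)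
    have hv : ‖fld (v 0)‖ ≤ P * (C * ‖grad v₀‖) := by
      rw [h.init_v]
      exact (hP.2 _).trans (mul_le_mul_of_nonneg_left (S.intV_stable v₀ hv₀) hP.1.le)
    have hC₁ := C₁_le hM C hτ0 hh (norm_nonneg (fld (u 0))) (norm_nonneg (fld (v 0))) hu hv
    have hC₂ := C₂_le hM P K C hτ0 hh
    refine ⟨D₃_le M d hτ0 hh, D₄_le hM P K hτ0 hh, hC₁, hC₂, fun hstep n hn => ?_⟩
    refine (velocityEnergy_le hM hP hK hτ0 h hstep hn).trans ?_
    exact mul_le_mul hC₁ (Real.exp_le_exp.2 (mul_le_mul_of_nonneg_right hC₂ (by positivity)))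
      (Real.exp_pos _).le (C₁_nonneg hM C 1 _ _ one_pos)
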